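/- Let $\chi_r(v)$ ($r\ge 1$, $v$ integers) denote the quadratic character modulo $r$, that is, the function which is fully multiplicative in both arguments, which coincides with the Legendre symbol when $r$ is an odd prime, and which for $r=2$ is $0$ if $v$ is even, $1$ if $v\equiv\pm1\pmod 8$ and $-1$ if $v\equiv\pm3\pmod 8$ (so $\chi_r(v)$ is the Kronecker symbol $\left(\frac{v}{r}\right)$). For a prime power $q$ and an integer $t$ with $|t|<2\sqrt q$ put $\Delta(t)=4q-t^2$ and, for $N\ge 1$, $$S_t(N)=\sum_{n=1}^{N}\chi_{\Delta(t)}(n).$$ Write $z\sim Z$ for $Z<z\le 2Z$. Then there is a function $\eta:\mathbb N\to\mathbb R$ with $\eta(L)\to0$ as $L\to\infty$ (depending on $L$ only) such that for every prime power $q$, every integer $R$ with $0<R<2R<2\sqrt q$, and all positive integers $L$ and $\nu$ with $$L^{\nu}\ge X,\qquad X=\max\left\{q\sqrt R,\ \frac{q^2}{R^2}\right\},$$ we have $$\sum_{t\sim R}\ \max_{N\sim L}|S_t(N)|\ \le\ R^{1-1/(4\nu)}\,L^{1+\eta(L)}\left(\frac{e\log(2L)}{\nu}+e\right)^{\nu/2},$$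 where $t$ and $N$ run over integers. -/

import Mathlib

/-- The quadratic character `χ_r` modulo `r ≥ 1`: the function that is fully multiplicative in both
arguments, equals the Legendre symbol when `r` is an odd prime, and for `r = 2` takes the value
`0` at even `v`, `1` at `v ≡ ±1 (mod 8)` and `-1` at `v ≡ ±3 (mod 8)` (this is `ZMod.χ₈`).
That is, the Kronecker symbol `(v / r)`: the Jacobi symbol for the odd part of `r`, times
`χ₂(v)` to the power of the exponent of `2` in `r`. -/
def quadChar (r : ℕ) (v : ℤ) : ℤ :=
  ZMod.χ₈ (v : ZMod 8) ^ r.factorization 2 * jacobiSym v (r / 2 ^ r.factorization 2)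

/-- `Δ(t) = 4q - t²`. -/
def Delta (q : ℕ) (t : ℤ) : ℤ := 4 * (q : ℤ) - t ^ 2

/-- `S_t(N) = ∑_{n=1}^{N} ξ_t(n)`, where `ξ_t` is the quadratic character modulo `Δ(t)`
(meaningful for `Δ(t) > 0`, that is, `|t| < 2√q`). -/
def charSum (q : ℕ) (t : ℤ) (N : ℕ) : ℤ :=
  ∑ n ∈ Finset.Icc 1 N, quadChar (Delta q t).toNat (n : ℤ)

/-- `max_{N ∼ L} |S_t(N)|`, the maximum over integers `L < N ≤ 2L` (a nonempty range for `L ≥ 1`;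
the maximum is taken of natural numbers). -/
def maxCharSum (q : ℕ) (t : ℤ) (L : ℕ) : ℕ :=
  (Finset.Ioc L (2 * L)).sup fun N => (charSum q t N).natAbs

/-- `X = max {q √R, q² / R²}`. -/
noncomputable def boundX (q R : ℕ) : ℝ :=
  max ((q : ℝ) * Real.sqrt (R : ℝ)) ((q : ℝ) ^ 2 / (R : ℝ) ^ 2)

/-! The maximum over `N` is removed by completion modulo `K = 2L`: every partial sum is dominated by
one weighted average, the same for all `N ≤ 2L`, of sums of full length `2L` twisted by additive
characters, and the weights add up to `O(log L)`. It remains to bound the sum over `t` for a single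
twist (`sum_norm_twisted_le`).

By Hölder this reduces to the `2ν`-th moment. The `ν`-th power of a twisted sum is a character sum
of length `(2L)^ν` whose coefficients are at most `boxCount`, so duality
(`sum_norm_sq_le_of_kernel_le`) gives the bound (largest row sum of the kernel) × (multiplicative
energy of `[1, 2L]`).

The kernel entry at `(t, t')` is a sum of the quadratic character modulo `Δ(t)Δ(t')`. If this
modulus is not a square, Pólya–Vinogradov gives `O(q log q)` (`abs_sum_quadChar_le`). If it is a
square, the entry is at most `(2L)^ν`, but for given `t` only `O(log q)` values `t'` occur, because
they solve `t'² + dy² = 4pᵏ` with one fixed `d` (`card_isSquare_mul_le`). As `q√R ≤ L^ν`, a row sum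
is `O(√R (2L)^ν log q)`, and the `2ν`-th root of `R^(2ν-1)·√R` is `R^(1-1/(4ν))`.

The energy is bounded through the `ν`-fold divisor function and Rankin's trick
(`sum_boxCount_sq_le_rankin`), which yields the factor in `e log(2L)/ν + e`. All remaining losses
are powers of `log L` uniform in `ν`, hence fit into `L ^ η(L)`. -/

/-! ### Dirichlet kernels and completion of partial sums. -/

/-- A majorant of the normalised Dirichlet kernel `K⁻¹ |∑_{m ≤ N} e(hm/K)|`, `0 ≤ h < K`. -/
noncomputable def kernelWeight (K h : ℕ) : ℝ :=
  if h = 0 then 1 else (1 / (h : ℝ) + 1 / ((K : ℝ) - h)) / 2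

lemma kernelWeight_nonneg {K h : ℕ} (hK : h < K) : 0 ≤ kernelWeight K h := by
  unfold kernelWeight
  split_ifs with h0
  · norm_num
  · have : (0 : ℝ) < (K : ℝ) - h := sub_pos.2 (by exact_mod_cast hK)
    positivity

/-- Jordan's inequality `sin(πy) ≥ 2y` handles `y ≤ 1/2`, where the term `1/(1 - y)` is not needed;
the bound is symmetric under `x ↦ 1 - x`. -/
lemma one_div_sin_pi_mul_le {x : ℝ} (h0 : 0 < x) (h1 : x < 1) :
    1 / Real.sin (Real.pi * x) ≤ (1 / x + 1 / (1 - x)) / 2 := by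
  have key : ∀ y : ℝ, 0 < y → y ≤ 1 / 2 → 1 / Real.sin (Real.pi * y) ≤ (1 / y + 1 / (1 - y)) / 2 := by
    intro y hy hy2
    have hs : 2 * y ≤ Real.sin (Real.pi * y) := by
      have := Real.mul_le_sin (x := Real.pi * y) (by positivity) (by nlinarith [Real.pi_pos])
      calc 2 * y = 2 / Real.pi * (Real.pi * y) := by field_simp
        _ ≤ _ := this
    have h3 : (0 : ℝ) ≤ 1 / (1 - y) := by
      apply one_div_nonneg.2; linarith
    calc 1 / Real.sin (Real.pi * y) ≤ 1 / (2 * y) := one_div_le_one_div_of_le (by positivity) hs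
      _ = (1 / y) / 2 := by field_simp
      _ ≤ _ := by linarith
  rcases le_total x (1 / 2) with h | h
  · exact key x h0 h
  · have := key (1 - x) (by linarith) (by linarith)
    rw [show Real.pi * (1 - x) = Real.pi - Real.pi * x by ring, Real.sin_pi_sub] at this
    rw [add_comm]; simpa using this

lemma norm_stdAddChar_sub_one {K : ℕ} [NeZero K] (h : ZMod K) :
    ‖ZMod.stdAddChar h - 1‖ = 2 * Real.sin (Real.pi * (h.val / K)) := by
  have hK : (0 : ℝ) < K := by exact_mod_cast NeZero.pos K
  have h1 : ZMod.stdAddChar h = Complex.exp (Complex.I * ((2 * Real.pi * (h.val / K) : ℝ) : ℂ)) := by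
    rw [ZMod.stdAddChar_apply, ZMod.toCircle_apply]
    congr 1; push_cast; ring
  rw [h1, Complex.norm_exp_I_mul_ofReal_sub_one, Real.norm_eq_abs, abs_of_nonneg]
  · ring_nf
  · have : 0 ≤ Real.sin (2 * Real.pi * (h.val / K) / 2) := by
      have hv : (h.val : ℝ) ≤ K := by exact_mod_cast (ZMod.val_lt h).le
      have hv' : (h.val : ℝ) / K ≤ 1 := (div_le_one hK).2 hv
      apply Real.sin_nonneg_of_nonneg_of_le_pi
      · positivity
      · nlinarith [Real.pi_pos]
    positivity

lemma norm_stdAddChar {K : ℕ} [NeZero K] (h : ZMod K) : ‖ZMod.stdAddChar h‖ = 1 := by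
  rw [ZMod.stdAddChar_apply, Circle.norm_coe]

lemma norm_sum_stdAddChar_le {K : ℕ} [NeZero K] (h : ZMod K) (hh : h ≠ 0) (N : ℕ) :
    ‖∑ m ∈ Finset.Icc 1 N, ZMod.stdAddChar (h * (m : ZMod K))‖ ≤ K * kernelWeight K h.val := by
  have hK : (0 : ℝ) < K := by exact_mod_cast NeZero.pos K
  set z := ZMod.stdAddChar h with hz
  have hpow : ∀ m : ℕ, ZMod.stdAddChar (h * (m : ZMod K)) = z ^ m := by
    intro m
    rw [hz, ← AddChar.map_nsmul_eq_pow, nsmul_eq_mul, mul_comm]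
  have hv0 : h.val ≠ 0 := by rwa [Ne, ZMod.val_eq_zero]
  have hvpos : (0 : ℝ) < h.val := by exact_mod_cast Nat.pos_of_ne_zero hv0
  have hvlt : (h.val : ℝ) < K := by exact_mod_cast ZMod.val_lt h
  have hx0 : 0 < (h.val : ℝ) / K := by positivity
  have hx1 : (h.val : ℝ) / K < 1 := (div_lt_one hK).2 hvlt
  have hsin : 0 < Real.sin (Real.pi * (h.val / K)) :=
    Real.sin_pos_of_pos_of_lt_pi (by positivity) (by nlinarith [Real.pi_pos])
  have hn : ‖z - 1‖ = 2 * Real.sin (Real.pi * (h.val / K)) := norm_stdAddChar_sub_one h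
  have hz1 : ‖z‖ = 1 := norm_stdAddChar h
  have hgeom : (∑ m ∈ Finset.Icc 1 N, z ^ m) * (z - 1) = z * (z ^ N - 1) := by
    have : ∑ m ∈ Finset.Icc 1 N, z ^ m = z * ∑ i ∈ Finset.range N, z ^ i := by
      rw [Finset.mul_sum, Finset.sum_bij (fun i _ => i - 1)]
      · intro a ha; simp at ha ⊢; omega
      · intro a ha b hb; simp at ha hb; omega
      · intro b hb; exact ⟨b + 1, by simp at hb ⊢; omega, by simp⟩
      · intro a ha; simp at ha; rw [← pow_succ']; congr 1; omega
    rw [this, mul_assoc, geom_sum_mul]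
  have hle : ‖∑ m ∈ Finset.Icc 1 N, z ^ m‖ * ‖z - 1‖ ≤ 2 := by
    rw [← norm_mul, hgeom, norm_mul, hz1, one_mul]
    calc ‖z ^ N - 1‖ ≤ ‖z ^ N‖ + ‖(1 : ℂ)‖ := norm_sub_le _ _
      _ = 2 := by rw [norm_pow, hz1]; norm_num
  simp_rw [hpow]
  have h2 := one_div_sin_pi_mul_le hx0 hx1
  have h3 : ‖∑ m ∈ Finset.Icc 1 N, z ^ m‖ ≤ 1 / Real.sin (Real.pi * (h.val / K)) := by
    rw [le_div_iff₀ hsin]; rw [hn] at hle; linarith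
  refine h3.trans (h2.trans (le_of_eq ?_))
  have : (K : ℝ) - h.val ≠ 0 := by linarith
  rw [kernelWeight, if_neg hv0]
  have : (1 : ℝ) - h.val / K = (K - h.val) / K := by field_simp
  rw [this]
  field_simp

lemma norm_sum_stdAddChar_le' {K : ℕ} [NeZero K] (h : ZMod K) {N : ℕ} (hN : N ≤ K) :
    ‖∑ m ∈ Finset.Icc 1 N, ZMod.stdAddChar (h * (m : ZMod K))‖ ≤ K * kernelWeight K h.val := by
  by_cases hh : h = 0
  · subst hh
    simp [kernelWeight, hN]
  · exact norm_sum_stdAddChar_le h hh N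

lemma sum_kernelWeight_range_le (K : ℕ) (hK : 0 < K) :
    ∑ h ∈ (Finset.range K).erase 0, kernelWeight K h ≤ 1 + Real.log K := by
  have h1 : ∑ h ∈ (Finset.range K).erase 0, kernelWeight K h
      = ∑ h ∈ Finset.range (K - 1), (1 / ((h : ℝ) + 1) + 1 / ((K : ℝ) - (h + 1))) / 2 := by
    symm
    apply Finset.sum_bij (fun h _ => h + 1)
    · intro a ha; simp at ha ⊢; omega
    · intro a _ b _ h; omega
    · intro b hb; simp at hb; exact ⟨b - 1, by simp; omega, by omega⟩
    · intro a _; rw [kernelWeight, if_neg (by omega)]; push_cast; rfl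
  -- The reflection `h ↦ K - h` turns the second half of the weight into the same harmonic sum as
  -- the first.
  have h2 : ∑ h ∈ Finset.range (K - 1), 1 / ((K : ℝ) - (h + 1))
      = ∑ h ∈ Finset.range (K - 1), 1 / ((h : ℝ) + 1) := by
    rw [← Finset.sum_range_reflect]
    apply Finset.sum_congr rfl
    intro a ha
    rw [Finset.mem_range] at ha
    have : ((K - 1 - 1 - a : ℕ) : ℝ) = K - 1 - 1 - a := by
      rw [Nat.cast_sub (by omega), Nat.cast_sub (by omega), Nat.cast_sub (by omega)]; simp
    rw [this]; congr 1; ring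
  have h3 : ∑ h ∈ Finset.range (K - 1), 1 / ((h : ℝ) + 1) = (harmonic (K - 1) : ℝ) := by
    simp [harmonic]
  rw [h1, ← Finset.sum_div, Finset.sum_add_distrib, h2, h3, add_self_div_two]
  refine (harmonic_le_one_add_log _).trans ?_
  rcases Nat.eq_zero_or_pos (K - 1) with h0 | h0
  · rw [h0]; simp
    exact Real.log_natCast_nonneg _
  · have : Real.log ((K - 1 : ℕ) : ℝ) ≤ Real.log K :=
      Real.log_le_log (by exact_mod_cast h0) (by exact_mod_cast Nat.sub_le _ _)
    linarith

lemma sum_zmod_val {K : ℕ} [NeZero K] (g : ℕ → ℝ) :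
    ∑ h : ZMod K, g h.val = ∑ h ∈ Finset.range K, g h := by
  apply Finset.sum_bij (fun h _ => h.val)
  · intro a _; simpa using ZMod.val_lt a
  · intro a _ b _ h; exact ZMod.val_injective K h
  · intro b hb; exact ⟨(b : ZMod K), Finset.mem_univ _, ZMod.val_cast_of_lt (by simpa using hb)⟩
  · intros; rfl

lemma sum_kernelWeight_ne_zero_le (K : ℕ) [NeZero K] :
    ∑ h ∈ Finset.univ.erase (0 : ZMod K), kernelWeight K h.val ≤ 1 + Real.log K := by
  have h0 := sum_zmod_val (K := K) (kernelWeight K)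
  rw [← Finset.add_sum_erase _ _ (Finset.mem_univ (0 : ZMod K)),
    ← Finset.add_sum_erase _ _ (Finset.mem_range.2 (NeZero.pos K)), ZMod.val_zero] at h0
  rw [add_left_cancel h0]
  exact sum_kernelWeight_range_le K (NeZero.pos K)

lemma sum_kernelWeight_le (K : ℕ) [NeZero K] :
    ∑ h : ZMod K, kernelWeight K h.val ≤ 2 + Real.log K := by
  rw [← Finset.add_sum_erase _ _ (Finset.mem_univ (0 : ZMod K)), ZMod.val_zero]
  have := sum_kernelWeight_ne_zero_le K
  have h1 : kernelWeight K 0 = 1 := by simp [kernelWeight]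
  linarith

/-- Completion: a partial sum is an average of additively twisted full sums. -/
lemma norm_partial_sum_le {K N : ℕ} [NeZero K] (hN : N ≤ K) (f : ℕ → ℂ) :
    ‖∑ n ∈ Finset.Icc 1 N, f n‖ ≤ ∑ h : ZMod K,
      kernelWeight K h.val * ‖∑ n ∈ Finset.Icc 1 K, f n * ZMod.stdAddChar (-(h * (n : ZMod K)))‖ := by
  have hK : (0 : ℝ) < K := by exact_mod_cast NeZero.pos K
  -- Since `N ≤ K`, numbers in `[1, K]` are congruent modulo `K` only if equal, so orthogonality
  -- produces the exact indicator of `n ≤ N`.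
  have horth : ∀ n ∈ Finset.Icc 1 K, ∑ m ∈ Finset.Icc 1 N, ∑ h : ZMod K,
      ZMod.stdAddChar (h * ((m : ZMod K) - (n : ZMod K))) = if n ∈ Finset.Icc 1 N then (K : ℂ) else 0 := by
    intro n hn
    have hinj : ∀ m ∈ Finset.Icc 1 N, ((m : ZMod K) - (n : ZMod K) = 0 ↔ m = n) := by
      intro m hm
      simp only [Finset.mem_Icc] at hm hn
      rw [sub_eq_zero, ZMod.natCast_eq_natCast_iff]
      refine ⟨fun h => ?_, fun h => h ▸ rfl⟩
      have h' : m - 1 ≡ n - 1 [MOD K] := by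
        apply Nat.ModEq.add_right_cancel' 1
        rwa [Nat.sub_add_cancel hm.1, Nat.sub_add_cancel hn.1]
      have := Nat.ModEq.eq_of_lt_of_lt h' (by omega) (by omega)
      omega
    have : ∀ m ∈ Finset.Icc 1 N, ∑ h : ZMod K, ZMod.stdAddChar (h * ((m : ZMod K) - (n : ZMod K)))
        = if m = n then (K : ℂ) else 0 := by
      intro m hm
      rw [AddChar.sum_mulShift _ (ZMod.isPrimitive_stdAddChar K), ZMod.card]
      simp only [hinj m hm]
      split_ifs <;> simp
    rw [Finset.sum_congr rfl this, Finset.sum_ite_eq']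
  have hid : (K : ℂ) * ∑ n ∈ Finset.Icc 1 N, f n = ∑ h : ZMod K,
      (∑ m ∈ Finset.Icc 1 N, ZMod.stdAddChar (h * (m : ZMod K))) *
        ∑ n ∈ Finset.Icc 1 K, f n * ZMod.stdAddChar (-(h * (n : ZMod K))) := by
    have hsub : Finset.Icc 1 N ⊆ Finset.Icc 1 K := Finset.Icc_subset_Icc_right hN
    have e1 : (K : ℂ) * ∑ n ∈ Finset.Icc 1 N, f n
        = ∑ n ∈ Finset.Icc 1 K, f n * (if n ∈ Finset.Icc 1 N then (K : ℂ) else 0) := by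
      rw [Finset.mul_sum]
      simp only [mul_ite, mul_zero]
      rw [← Finset.sum_filter, Finset.filter_mem_eq_inter, Finset.inter_eq_right.2 hsub]
      exact Finset.sum_congr rfl fun _ _ => mul_comm _ _
    refine e1.trans ((Finset.sum_congr rfl fun n hn => congrArg (f n * ·) (horth n hn).symm).trans ?_)
    simp only [Finset.mul_sum, Finset.sum_mul]
    rw [Finset.sum_comm]
    rw [Finset.sum_congr rfl fun m _ => Finset.sum_comm, Finset.sum_comm]
    refine Finset.sum_congr rfl fun h _ => Finset.sum_comm.trans ?_
    refine Finset.sum_congr rfl fun n _ => Finset.sum_congr rfl fun m _ => ?_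
    rw [mul_sub, sub_eq_add_neg, AddChar.map_add_eq_mul]
    ring
  have : (K : ℝ) * ‖∑ n ∈ Finset.Icc 1 N, f n‖ ≤ K * ∑ h : ZMod K,
      kernelWeight K h.val * ‖∑ n ∈ Finset.Icc 1 K, f n * ZMod.stdAddChar (-(h * (n : ZMod K)))‖ := by
    have := congrArg norm hid
    rw [norm_mul, Complex.norm_natCast] at this
    rw [this, Finset.mul_sum]
    refine (norm_sum_le _ _).trans (Finset.sum_le_sum fun h _ => ?_)
    rw [norm_mul, ← mul_assoc]
    exact mul_le_mul_of_nonneg_right (norm_sum_stdAddChar_le' h hN) (norm_nonneg _)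
  exact le_of_mul_le_mul_left this hK

/-! ### Gauss sums and the Pólya–Vinogradov inequality. -/

-- Fourier inversion evaluated at `1`: the transform of `χ` is `k ↦ τ(χ) χ⁻¹(-k)`, and transforming
-- again brings in `τ(χ⁻¹)`.
open ZMod in
lemma DirichletCharacter.IsPrimitive.gaussSum_mul_gaussSum_inv {f : ℕ} [NeZero f]
    {χ : DirichletCharacter ℂ f} (hχ : χ.IsPrimitive) :
    gaussSum χ stdAddChar * gaussSum χ⁻¹ stdAddChar = f * χ (-1) := by
  have hinv : χ⁻¹.IsPrimitive := by
    rw [DirichletCharacter.isPrimitive_def] at hχ ⊢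
    rw [DirichletCharacter.conductor_inv, hχ]
  have h1 := congrFun (ZMod.dft_dft (N := f) (⇑χ)) 1
  have h2 : ZMod.dft (⇑χ) = fun k => gaussSum χ stdAddChar * (χ⁻¹ (-k)) := by
    ext k
    rw [hχ.fourierTransform_eq_inv_mul_gaussSum, mul_comm]
  rw [h2, ZMod.dft_const_mul] at h1
  have h3 := ZMod.dft_comp_neg (N := f) (⇑χ⁻¹)
  rw [h3] at h1
  simp only [smul_eq_mul] at h1
  rw [hinv.fourierTransform_eq_inv_mul_gaussSum] at h1
  simpa using h1

-- Conjugation gives `|τ(χ)| = |τ(χ⁻¹)|`, and the product of the two Gauss sums has absolute value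
-- `f`.
open ZMod in
lemma DirichletCharacter.IsPrimitive.norm_gaussSum {f : ℕ} [NeZero f]
    {χ : DirichletCharacter ℂ f} (hχ : χ.IsPrimitive) :
    ‖gaussSum χ stdAddChar‖ = Real.sqrt f := by
  have h1 := hχ.gaussSum_mul_gaussSum_inv
  have hinv : χ⁻¹.IsPrimitive := by
    rw [DirichletCharacter.isPrimitive_def] at hχ ⊢
    rw [DirichletCharacter.conductor_inv, hχ]
  have hu : ‖χ (-1)‖ = 1 := by
    simpa using DirichletCharacter.unit_norm_eq_one χ (-1 : (ZMod f)ˣ)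
  have h2 : star (gaussSum χ stdAddChar) = χ (-1) * gaussSum χ⁻¹ stdAddChar := by
    rw [star_gaussSum_eq]
    have : (stdAddChar (N := f))⁻¹ = stdAddChar.mulShift (-1 : ZMod f) := by
      ext x; simp [AddChar.mulShift_apply, AddChar.inv_apply]
    rw [this, gaussSum_mulShift_of_isPrimitive _ hinv, inv_inv]
  have h3 : ‖gaussSum χ stdAddChar‖ = ‖gaussSum χ⁻¹ stdAddChar‖ := by
    have := congrArg norm h2
    rwa [norm_star, norm_mul, hu, one_mul] at this
  have h4 := congrArg norm h1
  rw [norm_mul, norm_mul, ← h3, hu, mul_one, Complex.norm_natCast] at h4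
  rw [← h4, Real.sqrt_mul_self (norm_nonneg _)]

open ZMod in
/-- Pólya–Vinogradov for primitive characters. -/
lemma DirichletCharacter.IsPrimitive.norm_sum_le_sqrt_mul_log {f : ℕ} [NeZero f]
    {χ : DirichletCharacter ℂ f} (hχ : χ.IsPrimitive) (hf : f ≠ 1) (M : ℕ) :
    ‖∑ n ∈ Finset.Icc 1 M, χ (n : ZMod f)‖ ≤ Real.sqrt f * (1 + Real.log f) := by
  have hf0 : (0 : ℝ) < f := by exact_mod_cast NeZero.pos f
  have hinv : χ⁻¹.IsPrimitive := by
    rw [DirichletCharacter.isPrimitive_def] at hχ ⊢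
    rw [DirichletCharacter.conductor_inv, hχ]
  have h1 : ∀ n : ℕ, χ (n : ZMod f) * gaussSum χ⁻¹ stdAddChar
      = ∑ x : ZMod f, χ⁻¹ x * stdAddChar (x * (n : ZMod f)) := by
    intro n
    have := gaussSum_mulShift_of_isPrimitive stdAddChar hinv (n : ZMod f)
    rw [inv_inv] at this
    rw [← this, gaussSum]
    simp [AddChar.mulShift_apply, mul_comm]
  have h2 : (∑ n ∈ Finset.Icc 1 M, χ (n : ZMod f)) * gaussSum χ⁻¹ stdAddChar
      = ∑ x : ZMod f, χ⁻¹ x * ∑ n ∈ Finset.Icc 1 M, stdAddChar (x * (n : ZMod f)) := by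
    rw [Finset.sum_mul, Finset.sum_congr rfl fun n _ => h1 n, Finset.sum_comm]
    simp only [Finset.mul_sum]
  -- The frequency `0` drops out because `f ≠ 1`; every other kernel is bounded for all lengths, so
  -- no relation between `M` and `f` is needed.
  have h0 : χ⁻¹ (0 : ZMod f) = 0 := by
    have : Nontrivial (ZMod f) := ZMod.nontrivial_iff.2 hf
    exact MulChar.map_zero _
  have h3 := congrArg norm h2
  rw [norm_mul, hinv.norm_gaussSum,
    ← Finset.add_sum_erase _ _ (Finset.mem_univ (0 : ZMod f)), h0, zero_mul, zero_add] at h3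
  have h4 : ‖∑ n ∈ Finset.Icc 1 M, χ (n : ZMod f)‖ * Real.sqrt f ≤ f * (1 + Real.log f) := by
    rw [h3]
    refine (norm_sum_le _ _).trans (le_trans (Finset.sum_le_sum fun x hx => ?_)
      (le_trans (le_of_eq (Finset.mul_sum _ _ _).symm)
        (mul_le_mul_of_nonneg_left (sum_kernelWeight_ne_zero_le f) hf0.le)))
    rw [norm_mul]
    have := norm_sum_stdAddChar_le x (Finset.ne_of_mem_erase hx) M
    have hn : ‖χ⁻¹ x‖ ≤ 1 := DirichletCharacter.norm_le_one _ _
    exact (mul_le_of_le_one_left (norm_nonneg _) hn).trans this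
  have hs : 0 < Real.sqrt f := Real.sqrt_pos.2 hf0
  refine le_of_mul_le_mul_right (h4.trans (le_of_eq ?_)) hs
  nth_rewrite 1 [← Real.mul_self_sqrt hf0.le]
  ring

/-- In each pair `d`, `n / d` one member is at most `√n`. -/
lemma Nat.card_divisors_le_two_mul_sqrt (n : ℕ) : (n.divisors.card : ℝ) ≤ 2 * Real.sqrt n := by
  rcases Nat.eq_zero_or_pos n with rfl | hn
  · simp
  have h : n.divisors ⊆ Finset.Icc 1 n.sqrt ∪ (Finset.Icc 1 n.sqrt).image (n / ·) := by
    intro d hd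
    rw [Nat.mem_divisors] at hd
    obtain ⟨e, he⟩ := hd.1
    have hd0 : 0 < d := Nat.pos_of_dvd_of_pos hd.1 hn
    have he0 : 0 < e := Nat.pos_of_ne_zero (by rintro rfl; simp at he; omega)
    rw [Finset.mem_union, Finset.mem_image]
    rcases le_total d e with h | h
    · left; rw [Finset.mem_Icc]; exact ⟨hd0, Nat.le_sqrt.2 (he ▸ Nat.mul_le_mul_left d h)⟩
    · right; refine ⟨e, Finset.mem_Icc.2 ⟨he0, Nat.le_sqrt.2 (he ▸ Nat.mul_le_mul_right e h)⟩, ?_⟩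
      rw [he]; exact Nat.mul_div_cancel _ he0
  have h1 : n.divisors.card ≤ 2 * n.sqrt := by
    refine (Finset.card_le_card h).trans ((Finset.card_union_le _ _).trans ?_)
    have := Finset.card_image_le (s := Finset.Icc 1 n.sqrt) (f := (n / ·))
    simp at this ⊢
    omega
  have h2 : (n.sqrt : ℝ) ≤ Real.sqrt n := Real.nat_sqrt_le_real_sqrt
  have : (n.divisors.card : ℝ) ≤ 2 * n.sqrt := by exact_mod_cast h1
  linarith

open ArithmeticFunction in
lemma sum_moebius_divisors (n : ℕ) :
    ∑ d ∈ n.divisors, (moebius d) = if n = 1 then 1 else 0 := by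
  have := congrArg (fun F : ArithmeticFunction ℤ => F n) coe_zeta_mul_moebius
  simp only [coe_zeta_mul_apply] at this
  rw [this, one_apply]

/-- Pólya–Vinogradov for nontrivial characters. -/
theorem DirichletCharacter.norm_sum_le_of_ne_one {N : ℕ} [NeZero N]
    {χ : DirichletCharacter ℂ N} (hχ : χ ≠ 1) (M : ℕ) :
    ‖∑ n ∈ Finset.Icc 1 M, χ (n : ZMod N)‖ ≤ 2 * Real.sqrt N * (1 + Real.log N) := by
  set f := χ.conductor with hf
  have hfN : f ∣ N := χ.conductor_dvd_level
  have hf0 : f ≠ 0 := χ.conductor_ne_zero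
  have : NeZero f := ⟨hf0⟩
  have hf1 : f ≠ 1 := fun h => hχ (χ.eq_one_iff_conductor_eq_one.2 h)
  set ψ := χ.primitiveCharacter with hψ
  have hψp : ψ.IsPrimitive := χ.primitiveCharacter_isPrimitive
  obtain ⟨g, hg⟩ := hfN
  have hN0 : N ≠ 0 := NeZero.ne N
  have hg0 : g ≠ 0 := by rintro rfl; simp at hg; exact hN0 hg
  -- With `N = f g`, the imprimitive `χ` is `ψ` restricted to `n` coprime to `g`, since `ψ` already
  -- vanishes when `n` is not coprime to `f`; Möbius inversion encodes the restriction.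
  have hval : ∀ n : ℕ, 0 < n → χ (n : ZMod N)
      = ∑ d ∈ g.divisors with d ∣ n, (ArithmeticFunction.moebius d : ℂ) * ψ (n : ZMod f) := by
    intro n hn
    have hgcd : (g.divisors.filter (· ∣ n)) = (Nat.gcd g n).divisors := by
      ext d; simp [Nat.dvd_gcd_iff, hg0]
    have hs := sum_moebius_divisors (Nat.gcd g n)
    rw [← Finset.sum_mul, hgcd]
    have hs' : (∑ d ∈ (Nat.gcd g n).divisors, (ArithmeticFunction.moebius d : ℂ))
        = if Nat.gcd g n = 1 then 1 else 0 := by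
      exact_mod_cast congrArg (Int.cast : ℤ → ℂ) hs
    rw [hs']
    by_cases hc : Nat.Coprime n N
    · have h1 : Nat.gcd g n = 1 := by
        rw [hg] at hc
        exact (Nat.Coprime.coprime_mul_left_right hc).symm
      rw [if_pos h1, one_mul]
      have := χ.primitiveCharacter_apply_of_isCoprime (a := (n : ℤ)) (Nat.isCoprime_iff_coprime.2 hc)
      simpa using this.symm
    · have h1 : χ (n : ZMod N) = 0 := by
        apply MulChar.map_nonunit
        rwa [ZMod.isUnit_iff_coprime]
      rw [h1]
      by_cases hcf : Nat.Coprime n f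
      · have : Nat.gcd g n ≠ 1 := by
          intro h
          apply hc
          rw [hg]
          exact Nat.Coprime.mul_right hcf (Nat.Coprime.symm h)
        rw [if_neg this, zero_mul]
      · have : ψ (n : ZMod f) = 0 := by
          apply MulChar.map_nonunit
          rwa [ZMod.isUnit_iff_coprime]
        rw [this, mul_zero]
  have hsum : ∑ n ∈ Finset.Icc 1 M, χ (n : ZMod N) = ∑ d ∈ g.divisors,
      (ArithmeticFunction.moebius d : ℂ) * ψ (d : ZMod f) *
        ∑ m ∈ Finset.Icc 1 (M / d), ψ (m : ZMod f) := by
    rw [Finset.sum_congr rfl fun n hn => hval n (Finset.mem_Icc.1 hn).1]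
    simp only [Finset.sum_filter]
    rw [Finset.sum_comm]
    refine Finset.sum_congr rfl fun d hd => ?_
    have hd0 : 0 < d := Nat.pos_of_mem_divisors hd
    rw [← Finset.sum_filter, Finset.mul_sum]
    symm
    apply Finset.sum_bij (fun m _ => d * m)
    · intro m hm
      rw [Finset.mem_Icc] at hm
      rw [Finset.mem_filter, Finset.mem_Icc]
      refine ⟨⟨Nat.mul_pos hd0 hm.1, ?_⟩, dvd_mul_right _ _⟩
      calc d * m ≤ d * (M / d) := Nat.mul_le_mul_left _ hm.2
        _ ≤ M := Nat.mul_div_le M d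
    · intro a _ b _ h; exact Nat.eq_of_mul_eq_mul_left hd0 h
    · intro n hn
      rw [Finset.mem_filter, Finset.mem_Icc] at hn
      obtain ⟨m, rfl⟩ := hn.2
      refine ⟨m, Finset.mem_Icc.2 ⟨Nat.pos_of_mul_pos_left hn.1.1, ?_⟩, rfl⟩
      exact (Nat.le_div_iff_mul_le hd0).2 (by rw [mul_comm]; exact hn.1.2)
    · intro m _
      push_cast
      rw [map_mul]; ring
  rw [hsum]
  have hbound : ∀ d ∈ g.divisors, ‖(ArithmeticFunction.moebius d : ℂ) * ψ (d : ZMod f) *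
      ∑ m ∈ Finset.Icc 1 (M / d), ψ (m : ZMod f)‖ ≤ Real.sqrt f * (1 + Real.log f) := by
    intro d _
    rw [norm_mul, norm_mul]
    have h1 : ‖(ArithmeticFunction.moebius d : ℂ)‖ ≤ 1 := by
      rw [Complex.norm_intCast]
      exact_mod_cast ArithmeticFunction.abs_moebius_le_one
    have h2 : ‖ψ (d : ZMod f)‖ ≤ 1 := DirichletCharacter.norm_le_one _ _
    exact (mul_le_of_le_one_left (norm_nonneg _) (mul_le_one₀ h1 (norm_nonneg _) h2)).trans
      (hψp.norm_sum_le_sqrt_mul_log hf1 _)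
  refine (norm_sum_le _ _).trans ((Finset.sum_le_sum hbound).trans ?_)
  rw [Finset.sum_const, nsmul_eq_mul]
  have hlog : Real.log f ≤ Real.log N := by
    apply Real.log_le_log (by exact_mod_cast Nat.pos_of_ne_zero hf0)
    exact_mod_cast Nat.le_of_dvd (Nat.pos_of_ne_zero hN0) ⟨g, hg⟩
  have hlog0 : 0 ≤ Real.log f := Real.log_natCast_nonneg f
  have hsq : Real.sqrt N = Real.sqrt g * Real.sqrt f := by
    rw [← Real.sqrt_mul (by positivity)]; congr 1; rw [hg]; push_cast; ring
  -- The divisor sum over `g` costs at most `2√g`, which combines with `√f` to give exactly `2√N`.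
  calc (g.divisors.card : ℝ) * (Real.sqrt f * (1 + Real.log f))
      ≤ (2 * Real.sqrt g) * (Real.sqrt f * (1 + Real.log N)) := by
        gcongr
        exact Nat.card_divisors_le_two_mul_sqrt g
    _ = _ := by rw [hsq]; ring

/-! ### The quadratic character as a nontrivial Dirichlet character. -/

lemma quadChar_mul_right {r s : ℕ} (hr : r ≠ 0) (hs : s ≠ 0) (v : ℤ) :
    quadChar (r * s) v = quadChar r v * quadChar s v := by
  unfold quadChar
  rw [Nat.ordCompl_mul, Nat.factorization_mul hr hs, Finsupp.add_apply, pow_add,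
    jacobiSym.mul_right' v (Nat.ordCompl_pos 2 hr).ne' (Nat.ordCompl_pos 2 hs).ne']
  ring

lemma quadChar_one_left (v : ℤ) : quadChar 1 v = 1 := by
  simp [quadChar]

lemma quadChar_pow_right {r : ℕ} (hr : r ≠ 0) (a : ℕ) (v : ℤ) :
    quadChar (r ^ a) v = quadChar r v ^ a := by
  induction a with
  | zero => simp [quadChar_one_left]
  | succ a ih => rw [pow_succ, quadChar_mul_right (pow_ne_zero _ hr) hr, ih, pow_succ]

lemma quadChar_mul_left (r : ℕ) (v w : ℤ) :
    quadChar r (v * w) = quadChar r v * quadChar r w := by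
  unfold quadChar
  rw [jacobiSym.mul_left, Int.cast_mul, map_mul, mul_pow]
  ring

lemma quadChar_one_right (r : ℕ) : quadChar r 1 = 1 := by
  simp [quadChar]

lemma quadChar_of_odd {r : ℕ} (hr : Odd r) (v : ℤ) : quadChar r v = jacobiSym v r := by
  have : r.factorization 2 = 0 :=
    Nat.factorization_eq_zero_of_not_dvd (Nat.two_dvd_ne_zero.2 (Nat.odd_iff.1 hr))
  simp [quadChar, this]

lemma quadChar_two (v : ℤ) : quadChar 2 v = ZMod.χ₈ v := by
  simp [quadChar, Nat.Prime.factorization_self Nat.prime_two]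

lemma abs_quadChar_le_one (r : ℕ) (v : ℤ) : |quadChar r v| ≤ 1 := by
  unfold quadChar
  rw [abs_mul, abs_pow]
  have h1 : |ZMod.χ₈ (v : ZMod 8)| ≤ 1 := by
    generalize (v : ZMod 8) = x
    revert x; decide
  have h2 : |jacobiSym v (r / 2 ^ r.factorization 2)| ≤ 1 := by
    rcases jacobiSym.trichotomy v (r / 2 ^ r.factorization 2) with h | h | h <;> simp [h]
  exact mul_le_one₀ (pow_le_one₀ (abs_nonneg _) h1) (abs_nonneg _) h2

lemma quadChar_eq_zero {r p : ℕ} {v : ℤ} (hr : r ≠ 0) (hp : p.Prime) (hpr : p ∣ r)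
    (hpv : (p : ℤ) ∣ v) : quadChar r v = 0 := by
  obtain ⟨s, rfl⟩ := hpr
  have hs : s ≠ 0 := right_ne_zero_of_mul hr
  rw [quadChar_mul_right hp.ne_zero hs]
  obtain ⟨w, rfl⟩ := hpv
  suffices quadChar p ((p : ℤ) * w) = 0 by rw [this, zero_mul]
  rw [quadChar_mul_left]
  suffices quadChar p (p : ℤ) = 0 by rw [this, zero_mul]
  rcases hp.eq_two_or_odd' with rfl | hodd
  · rw [quadChar_two]; decide
  · rw [quadChar_of_odd hodd, jacobiSym.eq_zero_iff]
    refine ⟨hp.ne_zero, ?_⟩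
    simpa using hp.ne_one

/-- A period of `v ↦ quadChar r v`. -/
def quadLevel (r : ℕ) : ℕ := if Odd r then r else 8 * r

lemma quadLevel_le (r : ℕ) : quadLevel r ≤ 8 * r := by
  unfold quadLevel; split_ifs <;> omega

lemma quadLevel_ne_zero {r : ℕ} (hr : r ≠ 0) : quadLevel r ≠ 0 := by
  unfold quadLevel; split_ifs <;> omega

lemma quadChar_congr {r : ℕ} {v w : ℤ} (h : (quadLevel r : ℤ) ∣ v - w) :
    quadChar r v = quadChar r w := by
  unfold quadLevel at h
  split_ifs at h with hr
  · rw [quadChar_of_odd hr, quadChar_of_odd hr]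
    exact jacobiSym.mod_left' (Int.modEq_iff_dvd.2 h).symm
  · push_cast at h
    unfold quadChar
    have h1 : (v : ZMod 8) = (w : ZMod 8) := by
      rw [eq_comm, ZMod.intCast_eq_intCast_iff_dvd_sub]
      exact (dvd_mul_right _ _).trans h
    have h2 : v % ((r / 2 ^ r.factorization 2 : ℕ) : ℤ) = w % ((r / 2 ^ r.factorization 2 : ℕ) : ℤ) := by
      refine (Int.modEq_iff_dvd.2 (dvd_trans ?_ h)).symm
      exact dvd_mul_of_dvd_right (by exact_mod_cast Nat.ordCompl_dvd r 2) _
    rw [h1, jacobiSym.mod_left' h2]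

/-- `quadChar r` as a Dirichlet character. -/
noncomputable def quadDirichlet (r : ℕ) (hr : r ≠ 0) : DirichletCharacter ℂ (quadLevel r) where
  toFun x := (quadChar r (x.val : ℤ) : ℂ)
  map_one' := by
    have : NeZero (quadLevel r) := ⟨quadLevel_ne_zero hr⟩
    have h : quadChar r (((1 : ZMod (quadLevel r)).val : ℕ) : ℤ) = quadChar r 1 := by
      apply quadChar_congr
      rw [← ZMod.intCast_eq_intCast_iff_dvd_sub]; simp
    rw [h, quadChar_one_right]; simp
  map_mul' x y := by
    have : NeZero (quadLevel r) := ⟨quadLevel_ne_zero hr⟩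
    have h : quadChar r ((x * y).val : ℤ) = quadChar r ((x.val : ℤ) * (y.val : ℤ)) := by
      apply quadChar_congr
      rw [← ZMod.intCast_eq_intCast_iff_dvd_sub]; simp
    rw [h, quadChar_mul_left]; push_cast; rfl
  map_nonunit' x hx := by
    have : NeZero (quadLevel r) := ⟨quadLevel_ne_zero hr⟩
    rw [← ZMod.natCast_zmod_val x, ZMod.isUnit_iff_coprime, Nat.Prime.not_coprime_iff_dvd] at hx
    obtain ⟨p, hp, h1, h2⟩ := hx
    have hpr : p ∣ r := by
      -- The factor `8` in the level occurs only for even `r`, so `r` and its level have the same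
      -- prime divisors.
      unfold quadLevel at h2
      split_ifs at h2 with ho
      · exact h2
      · rcases (Nat.Prime.dvd_mul hp).1 h2 with h | h
        · have : p ∣ 2 := hp.dvd_of_dvd_pow (show p ∣ 2 ^ 3 from h)
          exact this.trans (even_iff_two_dvd.1 (Nat.not_odd_iff_even.1 ho))
        · exact h
    rw [quadChar_eq_zero hr hp hpr (by exact_mod_cast h1)]; simp

lemma quadDirichlet_apply {r : ℕ} (hr : r ≠ 0) (n : ℕ) :
    quadDirichlet r hr (n : ZMod (quadLevel r)) = (quadChar r n : ℂ) := by
  have : NeZero (quadLevel r) := ⟨quadLevel_ne_zero hr⟩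
  change ((quadChar r (((n : ZMod (quadLevel r)).val : ℕ) : ℤ) : ℤ) : ℂ) = _
  congr 1
  apply quadChar_congr
  rw [← ZMod.intCast_eq_intCast_iff_dvd_sub]; simp

lemma exists_odd_factorization {r : ℕ} (hr : r ≠ 0) (hsq : ¬ IsSquare r) :
    ∃ p, p.Prime ∧ Odd (r.factorization p) := by
  by_contra! h
  apply hsq
  have h' : ∀ p, Even (r.factorization p) := by
    intro p
    by_cases hp : p.Prime
    · exact Nat.not_odd_iff_even.1 (h p hp)
    · rw [Nat.factorization_eq_zero_of_not_prime _ hp]; exact Even.zero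
  rw [← Nat.prod_factorization_pow_eq_self hr]
  refine Finset.isSquare_prod _ fun p _ => (h' p).isSquare_pow p

lemma exists_quadChar_prime_eq_neg_one {p : ℕ} (hp : p.Prime) (hp2 : p ≠ 2) :
    ∃ n : ℕ, quadChar p n = -1 := by
  have : Fact p.Prime := ⟨hp⟩
  obtain ⟨a, ha⟩ := FiniteField.exists_nonsquare (F := ZMod p) (by rwa [ZMod.ringChar_zmod_n])
  refine ⟨a.val, ?_⟩
  rw [quadChar_of_odd (hp.odd_of_ne_two hp2), ← jacobiSym.legendreSym.to_jacobiSym,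
    legendreSym.eq_neg_one_iff]
  simpa using ha

/-- Write `r = pᵃ m` with `a` odd and `p ∤ m`. The levels of `p` and `m` are coprime (if `p = 2`,
then `m` is odd and carries no factor `8`), so the Chinese remainder theorem gives `n` with value
`-1` at `p` and `n ≡ 1` modulo the level of `m`. -/
lemma exists_quadChar_eq_neg_one {r : ℕ} (hr : r ≠ 0) (hsq : ¬ IsSquare r) :
    ∃ n : ℕ, quadChar r n = -1 := by
  obtain ⟨p, hp, ha⟩ := exists_odd_factorization hr hsq
  set a := r.factorization p with hadef
  set m := r / p ^ a with hm
  have hrm : p ^ a * m = r := Nat.ordProj_mul_ordCompl_eq_self r p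
  have hm0 : m ≠ 0 := (Nat.ordCompl_pos p hr).ne'
  have hpm : ¬ p ∣ m := Nat.not_dvd_ordCompl hp hr
  have hval : ∀ v, quadChar r v = quadChar p v ^ a * quadChar m v := by
    intro v
    rw [← hrm, quadChar_mul_right (pow_ne_zero _ hp.ne_zero) hm0, quadChar_pow_right hp.ne_zero]
  have key : ∃ n : ℕ, quadChar p n = -1 ∧ quadChar m n = 1 := by
    have hcop : Nat.Coprime (quadLevel p) (quadLevel m) := by
      by_cases hp2 : p = 2
      · subst hp2
        have hmo : Odd m := Nat.odd_iff.2 (Nat.two_dvd_ne_zero.1 hpm)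
        have h16 : quadLevel 2 = 2 ^ 4 := by decide
        rw [h16, quadLevel, if_pos hmo]
        exact Nat.Coprime.pow_left 4 hmo.coprime_two_left
      · have hpo : Odd p := hp.odd_of_ne_two hp2
        rw [quadLevel, if_pos hpo, hp.coprime_iff_not_dvd]
        intro h
        have : p ∣ 2 ^ 3 * m := by
          unfold quadLevel at h
          split_ifs at h
          · exact h.trans (dvd_mul_left _ _)
          · exact h
        rcases hp.dvd_mul.1 this with h | h
        · exact hp2 ((Nat.prime_dvd_prime_iff_eq hp Nat.prime_two).1 (hp.dvd_of_dvd_pow h))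
        · exact hpm h
    obtain ⟨b, hb⟩ : ∃ b : ℕ, quadChar p b = -1 := by
      by_cases hp2 : p = 2
      · subst hp2
        refine ⟨3, ?_⟩
        rw [quadChar_two]; decide
      · exact exists_quadChar_prime_eq_neg_one hp hp2
    obtain ⟨n, hn1, hn2⟩ := Nat.chineseRemainder hcop b 1
    refine ⟨n, ?_, ?_⟩
    · rw [← hb]
      apply quadChar_congr
      exact (Nat.modEq_iff_dvd.1 hn1.symm)
    · rw [← quadChar_one_right m]
      apply quadChar_congr
      exact_mod_cast (Nat.modEq_iff_dvd.1 hn2.symm)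
  obtain ⟨n, h1, h2⟩ := key
  exact ⟨n, by rw [hval, h1, h2, ha.neg_one_pow, mul_one]⟩

lemma quadDirichlet_ne_one {r : ℕ} (hr : r ≠ 0) (hsq : ¬ IsSquare r) :
    quadDirichlet r hr ≠ 1 := by
  intro h
  obtain ⟨n, hn⟩ := exists_quadChar_eq_neg_one hr hsq
  have h1 := quadDirichlet_apply hr n
  rw [h, hn] at h1
  by_cases hu : IsUnit (n : ZMod (quadLevel r))
  · rw [MulChar.one_apply hu] at h1
    norm_num at h1
  · rw [MulChar.map_nonunit _ hu] at h1
    norm_num at h1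

/-- Pólya–Vinogradov for the quadratic character modulo a non-square. -/
theorem abs_sum_quadChar_le {r : ℕ} (hr : r ≠ 0) (hsq : ¬ IsSquare r) (M : ℕ) :
    |∑ n ∈ Finset.Icc 1 M, (quadChar r n : ℝ)| ≤
      2 * Real.sqrt (8 * r) * (1 + Real.log (8 * r)) := by
  have : NeZero (quadLevel r) := ⟨quadLevel_ne_zero hr⟩
  have h := DirichletCharacter.norm_sum_le_of_ne_one (quadDirichlet_ne_one hr hsq) M
  simp_rw [quadDirichlet_apply hr] at h
  have e : ∑ n ∈ Finset.Icc 1 M, (quadChar r n : ℂ)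
      = ((∑ n ∈ Finset.Icc 1 M, (quadChar r n : ℝ) : ℝ) : ℂ) := by push_cast; rfl
  rw [e, Complex.norm_real, Real.norm_eq_abs] at h
  have hle : (quadLevel r : ℝ) ≤ 8 * r := by exact_mod_cast quadLevel_le r
  have hpos : (0 : ℝ) < quadLevel r := by exact_mod_cast NeZero.pos _
  refine h.trans ?_
  have hl0 : 0 ≤ Real.log (quadLevel r) := Real.log_natCast_nonneg _
  gcongr

/-! ### Counting the `t` for which `4q - t²` lies in a given square class. -/

/-- An elementary form of the fact that an element of norm `pᵏ` prime to `p` generates `𝔭ᵏ` or its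
conjugate. The product of the two expressions is `4pᵏ(y₂² - y₁²)`; for odd `p` they are not both
divisible by `p`, since their sum is `2t₁y₂`, so one of them absorbs all of `pᵏ`. -/
lemma dvd_or_dvd_of_norm_eq {p k : ℕ} (hp : p.Prime) {d t₁ y₁ t₂ y₂ : ℤ}
    (h₁ : t₁ ^ 2 + d * y₁ ^ 2 = 4 * p ^ k) (h₂ : t₂ ^ 2 + d * y₂ ^ 2 = 4 * p ^ k)
    (ht₁ : ¬ (p : ℤ) ∣ t₁) (ht₂ : ¬ (p : ℤ) ∣ t₂) :
    (p : ℤ) ^ k ∣ t₁ * y₂ - t₂ * y₁ ∨ (p : ℤ) ^ k ∣ t₁ * y₂ + t₂ * y₁ := by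
  rcases Nat.eq_zero_or_pos k with rfl | hk
  · simp
  have hpZ : Prime (p : ℤ) := Nat.prime_iff_prime_int.1 hp
  have hprod : (t₁ * y₂ - t₂ * y₁) * (t₁ * y₂ + t₂ * y₁) = 4 * p ^ k * (y₂ ^ 2 - y₁ ^ 2) := by
    linear_combination y₂ ^ 2 * h₁ - y₁ ^ 2 * h₂
  by_cases hp2 : p = 2
  · subst hp2
    push_cast at *
    have hodd : ∀ t y : ℤ, t ^ 2 + d * y ^ 2 = 4 * 2 ^ k → ¬ (2 : ℤ) ∣ t → Odd t ∧ Odd y := by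
      intro t y h ht
      have ht' : Odd t := Int.not_even_iff_odd.1 (by rwa [even_iff_two_dvd])
      refine ⟨ht', ?_⟩
      by_contra hy
      rw [Int.not_odd_iff_even, even_iff_two_dvd] at hy
      obtain ⟨z, rfl⟩ := hy
      apply ht
      apply Int.prime_two.dvd_of_dvd_pow (n := 2)
      exact ⟨2 * 2 ^ k - d * 2 * z ^ 2, by linear_combination h⟩
    obtain ⟨⟨a, rfl⟩, ⟨b, rfl⟩⟩ := hodd _ _ h₁ ht₁
    obtain ⟨⟨c, rfl⟩, ⟨e, rfl⟩⟩ := hodd _ _ h₂ ht₂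
    -- For `p = 2` all four variables are odd and both expressions are even. Their halves `A`, `B`
    -- have the odd sum `t₁y₂`, and `AB` still contains `2ᵏ`.
    set A : ℤ := 2 * a * e + a + e - (2 * c * b + c + b) with hA
    set B : ℤ := 2 * a * e + a + e + (2 * c * b + c + b) + 1 with hB
    have hAB : A * B = 2 ^ k * ((2 * e + 1) ^ 2 - (2 * b + 1) ^ 2) := by
      have : 4 * (A * B) = 4 * (2 ^ k * ((2 * e + 1) ^ 2 - (2 * b + 1) ^ 2)) := by
        rw [hA, hB]; linear_combination hprod
      linarith
    have e1 : (2 * a + 1) * (2 * e + 1) - (2 * c + 1) * (2 * b + 1) = A * 2 := by rw [hA]; ring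
    have e2 : (2 * a + 1) * (2 * e + 1) + (2 * c + 1) * (2 * b + 1) = B * 2 := by rw [hB]; ring
    rw [e1, e2]
    have hcop : ¬ ((2 : ℤ) ∣ A ∧ (2 : ℤ) ∣ B) := by
      rintro ⟨⟨x, hx⟩, ⟨y, hy⟩⟩
      have : A + B = 2 * (2 * a * e + a + e) + 1 := by rw [hA, hB]; ring
      omega
    have hdvd : (2 : ℤ) ^ k ∣ A * B := ⟨_, hAB⟩
    by_cases h2A : (2 : ℤ) ∣ A
    · left
      have : ¬ (2 : ℤ) ∣ B := fun h => hcop ⟨h2A, h⟩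
      exact (((Int.prime_two.coprime_iff_not_dvd.2 this).pow_left).dvd_of_dvd_mul_right hdvd).mul_right 2
    · right
      exact (((Int.prime_two.coprime_iff_not_dvd.2 h2A).pow_left).dvd_of_dvd_mul_left hdvd).mul_right 2
  · have hp2' : ¬ (p : ℤ) ∣ 2 := by
      intro h
      have : p ∣ 2 := by exact_mod_cast h
      exact hp2 ((Nat.prime_dvd_prime_iff_eq hp Nat.prime_two).1 this)
    have hy₂ : ¬ (p : ℤ) ∣ y₂ := by
      intro h
      apply ht₂
      apply hpZ.dvd_of_dvd_pow (n := 2)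
      have e : t₂ ^ 2 = 4 * p ^ k - d * y₂ ^ 2 := by linarith
      rw [e]
      exact dvd_sub ((dvd_pow_self _ hk.ne').mul_left _) ((h.pow two_ne_zero).mul_left _)
    have hdvd : (p : ℤ) ^ k ∣ (t₁ * y₂ - t₂ * y₁) * (t₁ * y₂ + t₂ * y₁) :=
      ⟨4 * (y₂ ^ 2 - y₁ ^ 2), by rw [hprod]; ring⟩
    by_cases hA : (p : ℤ) ∣ t₁ * y₂ - t₂ * y₁
    · left
      have hB : ¬ (p : ℤ) ∣ t₁ * y₂ + t₂ * y₁ := by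
        intro hB
        have : (p : ℤ) ∣ 2 * (t₁ * y₂) := by
          have h := dvd_add hA hB
          rwa [show t₁ * y₂ - t₂ * y₁ + (t₁ * y₂ + t₂ * y₁) = 2 * (t₁ * y₂) by ring] at h
        rcases hpZ.dvd_or_dvd this with h | h
        · exact hp2' h
        · rcases hpZ.dvd_or_dvd h with h | h
          · exact ht₁ h
          · exact hy₂ h
      exact ((hpZ.coprime_iff_not_dvd.2 hB).pow_left).dvd_of_dvd_mul_right hdvd
    · right
      exact ((hpZ.coprime_iff_not_dvd.2 hA).pow_left).dvd_of_dvd_mul_left hdvd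

/-- Put `α₁ = t₁ + y₁√-d` and `α₂ = t₂ ± y₂√-d`, with the sign for which `Q` divides the
`√-d`-coefficient of `ᾱ₁α₂`. Taking norms, `Q` divides the rational part too, so `ᾱ₁α₂ = Q(i +
j√-d)` with `i² + dj² = 16`, and `α₂ = α₁(i + j√-d)/4`. -/
lemma exists_small_coefficients {Q d t₁ y₁ t₂ y₂ : ℤ} (hQ : 0 < Q) (hd : 0 < d)
    (h₁ : t₁ ^ 2 + d * y₁ ^ 2 = 4 * Q) (h₂ : t₂ ^ 2 + d * y₂ ^ 2 = 4 * Q)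
    (hdvd : Q ∣ t₁ * y₂ - t₂ * y₁ ∨ Q ∣ t₁ * y₂ + t₂ * y₁) :
    ∃ i ∈ Finset.Icc (-4 : ℤ) 4, ∃ j ∈ Finset.Icc (-4 : ℤ) 4, t₂ = (t₁ * i - d * y₁ * j) / 4 := by
  have main : ∀ z : ℤ, t₂ ^ 2 + d * z ^ 2 = 4 * Q → Q ∣ t₁ * z - t₂ * y₁ →
      ∃ i ∈ Finset.Icc (-4 : ℤ) 4, ∃ j ∈ Finset.Icc (-4 : ℤ) 4,
        t₂ = (t₁ * i - d * y₁ * j) / 4 := by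
    rintro z h ⟨j, hj⟩
    have hid : (t₁ * t₂ + d * y₁ * z) ^ 2 + d * (t₁ * z - t₂ * y₁) ^ 2 = 16 * Q ^ 2 := by
      linear_combination (t₂ ^ 2 + d * z ^ 2) * h₁ + 4 * Q * h
    rw [hj] at hid
    have hi : Q ∣ t₁ * t₂ + d * y₁ * z := by
      rw [← Int.pow_dvd_pow_iff two_ne_zero]
      exact ⟨16 - d * j ^ 2, by linear_combination hid⟩
    obtain ⟨i, hi⟩ := hi
    rw [hi] at hid
    have hij : i ^ 2 + d * j ^ 2 = 16 := by
      have : Q ^ 2 * (i ^ 2 + d * j ^ 2) = Q ^ 2 * 16 := by linear_combination hid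
      exact mul_left_cancel₀ (pow_ne_zero 2 hQ.ne') this
    have hj2 : j ^ 2 ≤ 16 := by nlinarith [sq_nonneg i, sq_nonneg j]
    have hi2 : i ^ 2 ≤ 16 := by nlinarith [sq_nonneg i, mul_nonneg hd.le (sq_nonneg j)]
    refine ⟨i, Finset.mem_Icc.2 ⟨by nlinarith, by nlinarith⟩, j,
      Finset.mem_Icc.2 ⟨by nlinarith, by nlinarith⟩, ?_⟩
    have : Q * (t₁ * i - d * y₁ * j) = Q * (4 * t₂) := by
      linear_combination (-t₁) * hi + d * y₁ * hj + t₂ * h₁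
    have := mul_left_cancel₀ hQ.ne' this
    omega
  rcases hdvd with h | h
  · exact main y₂ h₂ h
  · refine main (-y₂) (by linarith) ?_
    rwa [← dvd_neg, show -(t₁ * -y₂ - t₂ * y₁) = t₁ * y₂ + t₂ * y₁ by ring]

/-- One solution determines all others up to the `9 · 9` choices of `(i, j)`. -/
lemma card_coprime_le {p k : ℕ} (hp : p.Prime) {d : ℤ} (hd : 0 < d) (S : Finset ℤ)
    (hS : ∀ t ∈ S, ∃ y : ℤ, t ^ 2 + d * y ^ 2 = 4 * p ^ k) (hSp : ∀ t ∈ S, ¬ (p : ℤ) ∣ t) :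
    S.card ≤ 81 := by
  rcases S.eq_empty_or_nonempty with rfl | ⟨t₁, ht₁⟩
  · simp
  obtain ⟨y₁, h₁⟩ := hS t₁ ht₁
  have hsub : S ⊆ (Finset.Icc (-4 : ℤ) 4 ×ˢ Finset.Icc (-4 : ℤ) 4).image
      fun x => (t₁ * x.1 - d * y₁ * x.2) / 4 := by
    intro t₂ ht₂
    obtain ⟨y₂, h₂⟩ := hS t₂ ht₂
    obtain ⟨i, hi, j, hj, h⟩ := exists_small_coefficients
      (pow_pos (by exact_mod_cast hp.pos) k) hd h₁ h₂
      (dvd_or_dvd_of_norm_eq hp h₁ h₂ (hSp _ ht₁) (hSp _ ht₂))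
    exact Finset.mem_image.2 ⟨(i, j), Finset.mem_product.2 ⟨hi, hj⟩, h.symm⟩
  exact (Finset.card_le_card hsub).trans (Finset.card_image_le.trans (by decide))

/-- The equation `t² + dy² = 4pᵏ` with `d > 0` squarefree has `O(k + 1)` solutions `t > 0`. -/
lemma card_representations_le {p : ℕ} (hp : p.Prime) {d : ℤ} (hd : 0 < d) (hsq : Squarefree d)
    (k : ℕ) : ∀ S : Finset ℤ, (∀ t ∈ S, 0 < t) →
      (∀ t ∈ S, ∃ y : ℤ, t ^ 2 + d * y ^ 2 = 4 * p ^ k) → S.card ≤ 85 * (k + 1) := by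
  have hpZ : Prime (p : ℤ) := Nat.prime_iff_prime_int.1 hp
  have hp0 : (0 : ℤ) < p := by exact_mod_cast hp.pos
  induction k using Nat.strong_induction_on with
  | _ k ih =>
  intro S hpos hS
  have hsplit := Finset.card_filter_add_card_filter_not (s := S) (fun t => (p : ℤ) ∣ t)
  have hcop : (S.filter fun t => ¬ (p : ℤ) ∣ t).card ≤ 81 :=
    card_coprime_le hp hd _ (fun t ht => hS t (Finset.mem_filter.1 ht).1)
      fun t ht => (Finset.mem_filter.1 ht).2
  suffices (S.filter fun t => (p : ℤ) ∣ t).card ≤ 85 * (k + 1) - 81 by omega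
  -- For `k < 2`, `p ≤ t` and `t² ≤ 4pᵏ` force `t ≤ 4`, whence `85 = 81 + 4`. For `k ≥ 2`, dividing
  -- the solution by `p` lowers `k` by `2`.
  by_cases hk : k < 2
  · have hsub : (S.filter fun t => (p : ℤ) ∣ t) ⊆ Finset.Icc 1 4 := by
      intro t ht
      rw [Finset.mem_filter] at ht
      obtain ⟨y, hy⟩ := hS t ht.1
      have ht0 := hpos t ht.1
      have hle : (p : ℤ) ≤ t := Int.le_of_dvd ht0 ht.2
      have hnn : 0 ≤ d * y ^ 2 := mul_nonneg hd.le (sq_nonneg y)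
      rw [Finset.mem_Icc]
      refine ⟨ht0, ?_⟩
      interval_cases k
      · simp at hy; nlinarith
      · simp at hy; nlinarith
    have := Finset.card_le_card hsub
    simp at this
    omega
  · have hinj : Set.InjOn (fun t : ℤ => t / p) (S.filter fun t => (p : ℤ) ∣ t) := by
      intro a ha b hb h
      simp only [Finset.coe_filter, Set.mem_ofPred_eq] at ha hb
      exact Int.ediv_left_inj ha.2 hb.2 |>.1 h
    rw [← Finset.card_image_of_injOn hinj]
    refine (ih (k - 2) (by omega) _ ?_ ?_).trans (by omega)
    · intro t ht
      obtain ⟨s, hs, rfl⟩ := Finset.mem_image.1 ht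
      rw [Finset.mem_filter] at hs
      exact Int.ediv_pos_of_pos_of_dvd (hpos s hs.1) hp0.le hs.2
    · intro t ht
      obtain ⟨s, hs, rfl⟩ := Finset.mem_image.1 ht
      rw [Finset.mem_filter] at hs
      obtain ⟨hs1, u, rfl⟩ := hs
      obtain ⟨y, hy⟩ := hS _ hs1
      obtain ⟨l, rfl⟩ : ∃ l, k = l + 2 := ⟨k - 2, by omega⟩
      -- Here squarefreeness matters: if `p ∤ y`, then `p² ∣ dy²` would give `p² ∣ d`.
      have hpy : (p : ℤ) ∣ y := by
        by_contra hpy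
        have h1 : (p : ℤ) ^ 2 ∣ d * y ^ 2 := ⟨4 * p ^ l - u ^ 2, by linear_combination hy⟩
        have h2 : IsCoprime ((p : ℤ) ^ 2) (y ^ 2) := (hpZ.coprime_iff_not_dvd.2 hpy).pow
        have h3 := h2.dvd_of_dvd_mul_right h1
        rw [pow_two] at h3
        exact hpZ.not_isUnit (hsq _ h3)
      obtain ⟨z, rfl⟩ := hpy
      refine ⟨z, ?_⟩
      simp only [Nat.add_sub_cancel]
      rw [Int.mul_ediv_cancel_left _ hp0.ne']
      apply mul_left_cancel₀ (pow_ne_zero 2 hp0.ne')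
      linear_combination hy

/-- For a prime power `q = pᵏ`, few values `4q - t²` lie in the square class of a given one. -/
lemma card_isSquare_mul_le {p k : ℕ} (hp : p.Prime) {D : ℕ} (hD : D ≠ 0) (S : Finset ℤ)
    (hpos : ∀ t ∈ S, 0 < t ∧ 0 < Delta (p ^ k) t)
    (hS : ∀ t ∈ S, IsSquare (D * (Delta (p ^ k) t).toNat)) : S.card ≤ 85 * (k + 1) := by
  -- Here `D = b²a` with `a` squarefree. If `D·Δ(t)` is a square then `Δ(t) = ae²`, that is, `t² +
  -- ae² = 4pᵏ` with the same `a` for all `t`.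
  obtain ⟨a, b, hab, ha⟩ := Nat.sq_mul_squarefree D
  have ha0 : a ≠ 0 := ha.ne_zero
  have hb0 : b ≠ 0 := by rintro rfl; simp at hab; exact hD hab.symm
  refine card_representations_le hp (d := (a : ℤ)) (by omega) (Int.squarefree_natCast.2 ha) k S
    (fun t ht => (hpos t ht).1) fun t ht => ?_
  obtain ⟨m, hm⟩ := hS t ht
  set E := (Delta (p ^ k) t).toNat with hE
  have h2 : b ∣ m := by
    rw [← Nat.pow_dvd_pow_iff two_ne_zero]
    exact ⟨a * E, by rw [pow_two m, ← hm, ← hab]; ring⟩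
  obtain ⟨n, rfl⟩ := h2
  have hn : a * E = n ^ 2 := by
    apply Nat.eq_of_mul_eq_mul_left (pow_pos (Nat.pos_of_ne_zero hb0) 2)
    calc b ^ 2 * (a * E) = D * E := by rw [← hab]; ring
      _ = _ := by rw [hm]; ring
  obtain ⟨e, rfl⟩ : a ∣ n := (ha.dvd_pow_iff_dvd two_ne_zero).1 ⟨E, hn.symm⟩
  have hEe : E = a * e ^ 2 := by
    apply Nat.eq_of_mul_eq_mul_left (Nat.pos_of_ne_zero ha0)
    rw [hn]; ring
  refine ⟨e, ?_⟩
  have h3 : (E : ℤ) = Delta (p ^ k) t := Int.toNat_of_nonneg (hpos t ht).2.le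
  rw [hEe, Delta] at h3
  push_cast at h3
  linarith

/-! ### The `ν`-fold divisor function and multiplicative energy. -/

/-- The `ν`-fold divisor function: the number of ways to write `n ≥ 1` as an ordered product of
`ν` positive integers. -/
def iteratedDivisorCount : ℕ → ℕ → ℕ
  | 0, n => if n = 1 then 1 else 0
  | ν + 1, n => ∑ d ∈ n.divisors, iteratedDivisorCount ν (n / d)

-- Every divisor of `ab` is a product of a divisor of `a` and one of `b`, so summing over pairs only
-- overcounts. No coprimality is needed.
open Pointwise in
lemma iteratedDivisorCount_mul_le (ν : ℕ) : ∀ {a b : ℕ}, a ≠ 0 → b ≠ 0 →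
    iteratedDivisorCount ν (a * b) ≤ iteratedDivisorCount ν a * iteratedDivisorCount ν b := by
  induction ν with
  | zero =>
    intro a b _ _
    simp only [iteratedDivisorCount, mul_eq_one]
    split_ifs <;> simp_all
  | succ ν ih =>
    intro a b ha hb
    simp only [iteratedDivisorCount]
    rw [Finset.sum_mul_sum, ← Finset.sum_product']
    calc ∑ d ∈ (a * b).divisors, iteratedDivisorCount ν (a * b / d)
        ≤ ∑ x ∈ a.divisors ×ˢ b.divisors, iteratedDivisorCount ν (a * b / (x.1 * x.2)) := by
          have h : (a * b).divisors = (a.divisors ×ˢ b.divisors).image fun x => x.1 * x.2 := by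
            rw [Nat.divisors_mul]; rfl
          rw [h]
          exact Finset.sum_image_le_of_nonneg (fun _ _ => Nat.zero_le _)
      _ ≤ _ := by
          refine Finset.sum_le_sum fun x hx => ?_
          rw [Finset.mem_product, Nat.mem_divisors, Nat.mem_divisors] at hx
          rw [Nat.mul_div_mul_comm hx.1.1 hx.2.1]
          refine ih ?_ ?_
          · exact (Nat.div_pos (Nat.le_of_dvd (Nat.pos_of_ne_zero ha) hx.1.1)
              (Nat.pos_of_dvd_of_pos hx.1.1 (Nat.pos_of_ne_zero ha))).ne'
          · exact (Nat.div_pos (Nat.le_of_dvd (Nat.pos_of_ne_zero hb) hx.2.1)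
              (Nat.pos_of_dvd_of_pos hx.2.1 (Nat.pos_of_ne_zero hb))).ne'

lemma iteratedDivisorCount_one (ν : ℕ) : iteratedDivisorCount ν 1 = 1 := by
  induction ν with
  | zero => rfl
  | succ ν ih => simp [iteratedDivisorCount, ih]

lemma iteratedDivisorCount_prod_le (ν : ℕ) {ι : Type*} (s : Finset ι) (f : ι → ℕ)
    (hf : ∀ i ∈ s, f i ≠ 0) :
    iteratedDivisorCount ν (∏ i ∈ s, f i) ≤ ∏ i ∈ s, iteratedDivisorCount ν (f i) := by
  classical
  induction s using Finset.induction_on with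
  | empty => simp [iteratedDivisorCount_one]
  | insert i s hi ih =>
    rw [Finset.prod_insert hi, Finset.prod_insert hi]
    have hs : ∀ j ∈ s, f j ≠ 0 := fun j hj => hf j (Finset.mem_insert_of_mem hj)
    refine (iteratedDivisorCount_mul_le ν (hf i (Finset.mem_insert_self _ _))
      (Finset.prod_ne_zero_iff.2 hs)).trans (Nat.mul_le_mul_left _ (ih hs))

lemma card_le_iteratedDivisorCount (ν : ℕ) : ∀ {m : ℕ}, m ≠ 0 → ∀ S : Finset (Fin ν → ℕ),
    (∀ f ∈ S, ∏ i, f i = m) → S.card ≤ iteratedDivisorCount ν m := by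
  induction ν with
  | zero =>
    intro m _ S hS
    rcases S.eq_empty_or_nonempty with rfl | ⟨f, hf⟩
    · simp
    · have := hS f hf
      simp at this
      rw [← this, iteratedDivisorCount_one]
      exact Finset.card_le_one_of_subsingleton S
  | succ ν ih =>
    intro m hm S hS
    have hmaps : Set.MapsTo (fun f : Fin (ν + 1) → ℕ => f 0) S m.divisors := by
      intro f hf
      rw [Finset.mem_coe, Nat.mem_divisors]
      refine ⟨?_, hm⟩
      rw [← hS f hf]
      exact Finset.dvd_prod_of_mem f (Finset.mem_univ 0)
    rw [Finset.card_eq_sum_card_fiberwise hmaps, iteratedDivisorCount]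
    refine Finset.sum_le_sum fun d hd => ?_
    have hdm := Nat.mem_divisors.1 hd
    have hd0 : 0 < d := Nat.pos_of_mem_divisors hd
    have hinj : Set.InjOn (fun f : Fin (ν + 1) → ℕ => Fin.tail f) (S.filter fun f => f 0 = d) := by
      intro f hf g hg h
      simp only [Finset.coe_filter, Set.mem_ofPred_eq] at hf hg
      rw [← Fin.cons_self_tail f, ← Fin.cons_self_tail g, hf.2, hg.2]
      exact congrArg _ h
    rw [← Finset.card_image_of_injOn hinj]
    refine ih (Nat.div_pos (Nat.le_of_dvd (Nat.pos_of_ne_zero hm) hdm.1) hd0).ne' _ fun g hg => ?_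
    obtain ⟨f, hf, rfl⟩ := Finset.mem_image.1 hg
    rw [Finset.mem_filter] at hf
    have h1 := hS f hf.1
    rw [Fin.prod_univ_succ, hf.2] at h1
    rw [← h1, Nat.mul_div_cancel_left _ hd0]
    rfl

/-- Number of ways to write `m` as an ordered product of `ν` factors from `[1, Y]`. -/
def boxCount (Y ν m : ℕ) : ℕ :=
  ((Fintype.piFinset fun _ : Fin ν => Finset.Icc 1 Y).filter fun f => ∏ i, f i = m).card

lemma prod_mem_Icc {Y ν : ℕ} {f : Fin ν → ℕ}
    (hf : f ∈ Fintype.piFinset fun _ : Fin ν => Finset.Icc 1 Y) :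
    ∏ i, f i ∈ Finset.Icc 1 (Y ^ ν) := by
  simp only [Fintype.mem_piFinset, Finset.mem_Icc] at hf ⊢
  refine ⟨Nat.succ_le_of_lt (Finset.prod_pos fun i _ => (hf i).1), ?_⟩
  calc ∏ i, f i ≤ ∏ _i : Fin ν, Y := Finset.prod_le_prod' fun i _ => (hf i).2
    _ = Y ^ ν := by simp

/-- The left side sums `boxCount` of `∏ f i` over all tuples `f`. Bounding `boxCount` by the
`ν`-fold divisor function and using submultiplicativity makes the sum over tuples factor. -/
lemma sum_boxCount_sq_le (Y ν : ℕ) :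
    ∑ m ∈ Finset.Icc 1 (Y ^ ν), boxCount Y ν m ^ 2
      ≤ (∑ n ∈ Finset.Icc 1 Y, iteratedDivisorCount ν n) ^ ν := by
  have h1 : ∑ m ∈ Finset.Icc 1 (Y ^ ν), boxCount Y ν m ^ 2
      = ∑ f ∈ Fintype.piFinset fun _ : Fin ν => Finset.Icc 1 Y, boxCount Y ν (∏ i, f i) := by
    rw [← Finset.sum_fiberwise_of_maps_to (fun f hf => prod_mem_Icc hf)]
    refine Finset.sum_congr rfl fun m _ => ?_
    rw [Finset.sum_congr rfl fun f hf => by rw [(Finset.mem_filter.1 hf).2],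
      Finset.sum_const, smul_eq_mul, pow_two]
    rfl
  have h2 : (∑ n ∈ Finset.Icc 1 Y, iteratedDivisorCount ν n) ^ ν
      = ∑ f ∈ Fintype.piFinset fun _ : Fin ν => Finset.Icc 1 Y,
        ∏ i, iteratedDivisorCount ν (f i) := by
    rw [← Finset.prod_univ_sum]; simp
  rw [h1, h2]
  refine Finset.sum_le_sum fun f hf => ?_
  have hf0 : ∀ i ∈ Finset.univ, f i ≠ 0 := by
    intro i _
    have := Finset.mem_Icc.1 (Fintype.mem_piFinset.1 hf i)
    omega
  refine le_trans ?_ (iteratedDivisorCount_prod_le ν Finset.univ f hf0)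
  exact card_le_iteratedDivisorCount ν (Finset.prod_ne_zero_iff.2 hf0) _
    fun g hg => (Finset.mem_filter.1 hg).2

lemma sum_rpow_neg_le {σ : ℝ} (hσ : 0 < σ) (Y : ℕ) :
    ∑ x ∈ Finset.Icc 1 Y, (x : ℝ) ^ (-(1 + σ)) ≤ 1 + 1 / σ := by
  rcases Nat.eq_zero_or_pos Y with rfl | hY
  · simp; positivity
  -- The subtracted term is the integral of `x^(-1-σ)` from `Y` to infinity; with it the induction
  -- telescopes.
  suffices ∑ x ∈ Finset.Icc 1 Y, (x : ℝ) ^ (-(1 + σ)) ≤ 1 + 1 / σ - (Y : ℝ) ^ (-σ) / σ by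
    have : 0 ≤ (Y : ℝ) ^ (-σ) / σ := by positivity
    linarith
  induction Y, hY using Nat.le_induction with
  | base => simp
  | succ n hn ih =>
    rw [Finset.sum_Icc_succ_top (by omega)]
    have hn0 : (0 : ℝ) < n := by exact_mod_cast hn
    have key : ((n + 1 : ℕ) : ℝ) ^ (-(1 + σ))
        ≤ (n : ℝ) ^ (-σ) / σ - ((n + 1 : ℕ) : ℝ) ^ (-σ) / σ := by
      push_cast
      have h1 : 1 / ((n : ℝ) + 1) ≤ Real.log ((n + 1) / n) := by
        have := Real.one_sub_inv_le_log_of_pos (x := ((n : ℝ) + 1) / n) (by positivity)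
        refine le_trans (le_of_eq ?_) this
        field_simp; ring
      have h2 : 1 + σ * (1 / ((n : ℝ) + 1)) ≤ (((n : ℝ) + 1) / n) ^ σ := by
        rw [Real.rpow_def_of_pos (by positivity)]
        have := Real.add_one_le_exp (Real.log (((n : ℝ) + 1) / n) * σ)
        nlinarith
      rw [Real.div_rpow (by positivity) hn0.le, le_div_iff₀ (by positivity)] at h2
      have e1 : ((n : ℝ) + 1) ^ (-(1 + σ)) = ((n : ℝ) + 1) ^ (-σ) * (1 / (n + 1)) := by
        rw [show -(1 + σ) = -σ + (-1) by ring, Real.rpow_add (by positivity), Real.rpow_neg_one,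
          one_div]
      have e2 : (n : ℝ) ^ (-σ) = ((n : ℝ) ^ σ)⁻¹ := Real.rpow_neg hn0.le _
      have e3 : ((n : ℝ) + 1) ^ (-σ) = (((n : ℝ) + 1) ^ σ)⁻¹ := Real.rpow_neg (by positivity) _
      have p1 : 0 < (n : ℝ) ^ σ := by positivity
      have p2 : 0 < ((n : ℝ) + 1) ^ σ := by positivity
      rw [e1, e2, e3, ← sub_div, le_div_iff₀ hσ]
      have : (((n : ℝ) + 1) ^ σ)⁻¹ * (1 / (n + 1)) * σ + (((n : ℝ) + 1) ^ σ)⁻¹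
          = (((n : ℝ) + 1) ^ σ)⁻¹ * (1 + σ * (1 / (n + 1))) := by ring
      have h4 : (((n : ℝ) + 1) ^ σ)⁻¹ * (1 + σ * (1 / (n + 1))) ≤ ((n : ℝ) ^ σ)⁻¹ := by
        rw [inv_mul_le_iff₀ p2, ← div_eq_mul_inv, le_div_iff₀ p1]
        exact h2
      linarith
    linarith

/-- A truncated form of `∑ d_ν(n) n⁻ˢ = ζ(s)^ν`: all factors of some `n ≤ Y` are at most `Y`, and
the extra products on the right are nonnegative. -/
lemma sum_iteratedDivisorCount_mul_rpow_le (s : ℝ) (Y ν : ℕ) :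
    ∑ n ∈ Finset.Icc 1 Y, (iteratedDivisorCount ν n : ℝ) * (n : ℝ) ^ (-s)
      ≤ (∑ x ∈ Finset.Icc 1 Y, (x : ℝ) ^ (-s)) ^ ν := by
  induction ν with
  | zero =>
    simp only [iteratedDivisorCount, pow_zero, Nat.cast_ite, Nat.cast_one, Nat.cast_zero, ite_mul,
      zero_mul, one_mul, Finset.sum_ite_eq']
    split_ifs <;> simp
  | succ ν ih =>
    rw [pow_succ']
    refine le_trans ?_ (mul_le_mul_of_nonneg_left ih (Finset.sum_nonneg fun _ _ => by positivity))
    rw [Finset.sum_mul_sum, ← Finset.sum_product']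
    have h1 : ∀ n ∈ Finset.Icc 1 Y, (iteratedDivisorCount (ν + 1) n : ℝ) * (n : ℝ) ^ (-s)
        = ∑ x ∈ (Finset.Icc 1 Y ×ˢ Finset.Icc 1 Y) with x.1 * x.2 = n,
          (x.1 : ℝ) ^ (-s) * ((iteratedDivisorCount ν x.2 : ℝ) * (x.2 : ℝ) ^ (-s)) := by
      intro n hn
      rw [Finset.mem_Icc] at hn
      rw [iteratedDivisorCount, Nat.cast_sum, Finset.sum_mul]
      apply Finset.sum_bij (fun d _ => (d, n / d))
      · intro d hd
        have hdn := Nat.dvd_of_mem_divisors hd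
        have hd0 := Nat.pos_of_mem_divisors hd
        have hle := Nat.le_of_dvd hn.1 hdn
        simp only [Finset.mem_filter, Finset.mem_product, Finset.mem_Icc]
        exact ⟨⟨⟨hd0, hle.trans hn.2⟩, Nat.div_pos hle hd0, (Nat.div_le_self _ _).trans hn.2⟩,
          Nat.mul_div_cancel' hdn⟩
      · intro a _ b _ h; exact (Prod.mk.inj h).1
      · rintro ⟨a, b⟩ hx
        simp only [Finset.mem_filter, Finset.mem_product, Finset.mem_Icc] at hx
        refine ⟨a, Nat.mem_divisors.2 ⟨⟨b, hx.2.symm⟩, by omega⟩, ?_⟩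
        rw [← hx.2, Nat.mul_div_cancel_left _ hx.1.1.1]
      · intro d hd
        have hdn := Nat.dvd_of_mem_divisors hd
        have : (n : ℝ) = d * ((n / d : ℕ) : ℝ) := by
          rw [← Nat.cast_mul, Nat.mul_div_cancel' hdn]
        rw [this, Real.mul_rpow (by positivity) (by positivity)]
        ring
    rw [Finset.sum_congr rfl h1, Finset.sum_fiberwise_eq_sum_filter]
    refine Finset.sum_le_sum_of_subset_of_nonneg (Finset.filter_subset _ _) fun _ _ _ => ?_
    positivity

/-- Rankin's bound for the summatory function of the `ν`-fold divisor function. -/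
lemma sum_iteratedDivisorCount_le {Y ν : ℕ} (hY : 2 ≤ Y) (hν : 0 < ν) :
    (∑ n ∈ Finset.Icc 1 Y, (iteratedDivisorCount ν n : ℝ))
      ≤ Y * (Real.exp 1 * Real.log Y / ν + Real.exp 1) ^ ν := by
  have hY0 : (0 : ℝ) < Y := by positivity
  have hν0 : (0 : ℝ) < ν := by exact_mod_cast hν
  have hlog : 0 < Real.log Y := Real.log_pos (by exact_mod_cast hY)
  -- This choice makes `Y^σ = e^ν` and `1 + 1/σ = 1 + log Y / ν`.
  set σ : ℝ := ν / Real.log Y with hσ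
  have hσ0 : 0 < σ := by positivity
  have h1 : ∑ n ∈ Finset.Icc 1 Y, (iteratedDivisorCount ν n : ℝ)
      ≤ (Y : ℝ) ^ (1 + σ) * ∑ n ∈ Finset.Icc 1 Y,
        (iteratedDivisorCount ν n : ℝ) * (n : ℝ) ^ (-(1 + σ)) := by
    rw [Finset.mul_sum]
    refine Finset.sum_le_sum fun n hn => ?_
    rw [Finset.mem_Icc] at hn
    have hn0 : (0 : ℝ) < n := by exact_mod_cast hn.1
    have : 1 ≤ (Y : ℝ) ^ (1 + σ) * (n : ℝ) ^ (-(1 + σ)) := by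
      rw [Real.rpow_neg hn0.le, ← div_eq_mul_inv, one_le_div (by positivity)]
      exact Real.rpow_le_rpow hn0.le (by exact_mod_cast hn.2) (by positivity)
    calc (iteratedDivisorCount ν n : ℝ) = iteratedDivisorCount ν n * 1 := by ring
      _ ≤ iteratedDivisorCount ν n * ((Y : ℝ) ^ (1 + σ) * (n : ℝ) ^ (-(1 + σ))) := by gcongr
      _ = _ := by ring
  have h2 : ∑ n ∈ Finset.Icc 1 Y, (iteratedDivisorCount ν n : ℝ) * (n : ℝ) ^ (-(1 + σ))
      ≤ (1 + 1 / σ) ^ ν :=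
    (sum_iteratedDivisorCount_mul_rpow_le _ _ _).trans
      (pow_le_pow_left₀ (Finset.sum_nonneg fun _ _ => by positivity) (sum_rpow_neg_le hσ0 Y) ν)
  have h3 : (Y : ℝ) ^ (1 + σ) = Y * Real.exp 1 ^ ν := by
    rw [Real.rpow_add hY0, Real.rpow_one, Real.rpow_def_of_pos hY0, hσ,
      mul_div_cancel₀ _ hlog.ne', ← Real.exp_nat_mul, mul_one]
  refine h1.trans ((mul_le_mul_of_nonneg_left h2 (by positivity)).trans (le_of_eq ?_))
  rw [h3, mul_assoc, ← mul_pow, hσ]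
  congr 2
  field_simp
  ring

/-- Bound for the number of solutions of `x₁⋯x_ν = y₁⋯y_ν` in `[1, Y]`. -/
lemma sum_boxCount_sq_le_rankin {Y ν : ℕ} (hY : 2 ≤ Y) (hν : 0 < ν) :
    ∑ m ∈ Finset.Icc 1 (Y ^ ν), (boxCount Y ν m : ℝ) ^ 2
      ≤ ((Y : ℝ) * (Real.exp 1 * Real.log Y / ν + Real.exp 1) ^ ν) ^ ν := by
  have h := sum_boxCount_sq_le Y ν
  have h' : ∑ m ∈ Finset.Icc 1 (Y ^ ν), (boxCount Y ν m : ℝ) ^ 2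
      ≤ (∑ n ∈ Finset.Icc 1 Y, (iteratedDivisorCount ν n : ℝ)) ^ ν := by exact_mod_cast h
  exact h'.trans (pow_le_pow_left₀ (Finset.sum_nonneg fun _ _ => by positivity)
    (sum_iteratedDivisorCount_le hY hν) ν)

/-! ### Duality and moments of twisted sums. -/

open ComplexConjugate in
/-- The dual form of the large sieve inequality for a real kernel. -/
lemma sum_norm_sq_le_of_kernel_le {ι κ : Type*} (T : Finset ι) (S : Finset κ) (χ : ι → κ → ℝ)
    (b : κ → ℂ) {Λ : ℝ} (hΛ0 : 0 ≤ Λ)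
    (hΛ : ∀ t ∈ T, ∑ t' ∈ T, |∑ m ∈ S, χ t m * χ t' m| ≤ Λ) :
    ∑ t ∈ T, ‖∑ m ∈ S, b m * χ t m‖ ^ 2 ≤ Λ * ∑ m ∈ S, ‖b m‖ ^ 2 := by
  set B : ι → ℂ := fun t => ∑ m ∈ S, b m * χ t m with hB
  set C : κ → ℂ := fun m => ∑ t ∈ T, conj (B t) * χ t m with hC
  set A := ∑ t ∈ T, ‖B t‖ ^ 2 with hA
  have hA0 : 0 ≤ A := Finset.sum_nonneg fun _ _ => by positivity
  have hAC : (A : ℂ) = ∑ m ∈ S, b m * C m := by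
    have : (A : ℂ) = ∑ t ∈ T, conj (B t) * B t := by
      rw [hA]; push_cast
      exact Finset.sum_congr rfl fun t _ => (Complex.conj_mul' _).symm
    rw [this]
    simp only [hC, Finset.mul_sum]
    rw [Finset.sum_comm]
    refine Finset.sum_congr rfl fun t _ => ?_
    conv_lhs => rw [hB]
    simp only [Finset.mul_sum]
    exact Finset.sum_congr rfl fun m _ => by ring
  have hle : A ≤ ∑ m ∈ S, ‖b m‖ * ‖C m‖ := by
    have h := congrArg norm hAC
    rw [Complex.norm_real, Real.norm_of_nonneg hA0] at h
    rw [h]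
    exact (norm_sum_le _ _).trans (Finset.sum_le_sum fun m _ => (norm_mul _ _).le)
  have hCC : ∑ m ∈ S, ‖C m‖ ^ 2 ≤ Λ * A := by
    have h1 : ((∑ m ∈ S, ‖C m‖ ^ 2 : ℝ) : ℂ) = ∑ t ∈ T, ∑ t' ∈ T,
        conj (B t) * B t' * ((∑ m ∈ S, χ t m * χ t' m : ℝ) : ℂ) := by
      push_cast
      have : ∀ m, (‖C m‖ : ℂ) ^ 2 = ∑ t ∈ T, ∑ t' ∈ T,
          conj (B t) * B t' * ((χ t m : ℂ) * χ t' m) := by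
        intro m
        rw [← Complex.mul_conj', hC, map_sum, Finset.sum_mul_sum]
        refine Finset.sum_congr rfl fun t _ => Finset.sum_congr rfl fun t' _ => ?_
        simp; ring
      rw [Finset.sum_congr rfl fun m _ => this m, Finset.sum_comm]
      refine Finset.sum_congr rfl fun t _ => ?_
      rw [Finset.sum_comm]
      exact Finset.sum_congr rfl fun t' _ => (Finset.mul_sum _ _ _).symm
    have h2 : ∑ m ∈ S, ‖C m‖ ^ 2 ≤ ∑ t ∈ T, ∑ t' ∈ T,
        ‖B t‖ * ‖B t'‖ * |∑ m ∈ S, χ t m * χ t' m| := by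
      have h := congrArg norm h1
      rw [Complex.norm_real, Real.norm_of_nonneg (Finset.sum_nonneg fun _ _ => by positivity)] at h
      rw [h]
      refine (norm_sum_le _ _).trans (Finset.sum_le_sum fun t _ => ?_)
      refine (norm_sum_le _ _).trans (Finset.sum_le_sum fun t' _ => ?_)
      rw [norm_mul, norm_mul, RCLike.norm_conj, Complex.norm_real, Real.norm_eq_abs]
    -- Schur's test: by `2xy ≤ x² + y²` and the symmetry of the kernel, a bound for the row sums is
    -- enough.
    have h3 : ∑ t ∈ T, ∑ t' ∈ T, ‖B t‖ * ‖B t'‖ * |∑ m ∈ S, χ t m * χ t' m|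
        ≤ ∑ t ∈ T, ∑ t' ∈ T, (‖B t‖ ^ 2 / 2 * |∑ m ∈ S, χ t m * χ t' m|
          + ‖B t'‖ ^ 2 / 2 * |∑ m ∈ S, χ t m * χ t' m|) := by
      refine Finset.sum_le_sum fun t _ => Finset.sum_le_sum fun t' _ => ?_
      rw [← add_mul]
      refine mul_le_mul_of_nonneg_right ?_ (abs_nonneg _)
      nlinarith [sq_nonneg (‖B t‖ - ‖B t'‖)]
    have h4 : ∑ t ∈ T, ∑ t' ∈ T, ‖B t‖ ^ 2 / 2 * |∑ m ∈ S, χ t m * χ t' m| ≤ Λ * A / 2 := by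
      calc _ ≤ ∑ t ∈ T, ‖B t‖ ^ 2 / 2 * Λ := by
            refine Finset.sum_le_sum fun t ht => ?_
            rw [← Finset.mul_sum]
            exact mul_le_mul_of_nonneg_left (hΛ t ht) (by positivity)
        _ = Λ * A / 2 := by rw [← Finset.sum_mul, ← Finset.sum_div]; ring
    have h5 : ∑ t ∈ T, ∑ t' ∈ T, ‖B t'‖ ^ 2 / 2 * |∑ m ∈ S, χ t m * χ t' m| ≤ Λ * A / 2 := by
      rw [Finset.sum_comm]
      refine le_trans (le_of_eq ?_) h4
      refine Finset.sum_congr rfl fun t _ => Finset.sum_congr rfl fun t' _ => ?_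
      congr 2
      exact Finset.sum_congr rfl fun m _ => mul_comm _ _
    simp only [Finset.sum_add_distrib] at h3
    linarith
  -- Cauchy–Schwarz bounds `A²` by a multiple of `A`; one factor `A` is then cancelled.
  have hcs : A ^ 2 ≤ (∑ m ∈ S, ‖b m‖ ^ 2) * (Λ * A) :=
    calc A ^ 2 ≤ (∑ m ∈ S, ‖b m‖ * ‖C m‖) ^ 2 := pow_le_pow_left₀ hA0 hle 2
      _ ≤ (∑ m ∈ S, ‖b m‖ ^ 2) * ∑ m ∈ S, ‖C m‖ ^ 2 := Finset.sum_mul_sq_le_sq_mul_sq _ _ _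
      _ ≤ _ := mul_le_mul_of_nonneg_left hCC (Finset.sum_nonneg fun _ _ => by positivity)
  rcases hA0.eq_or_lt with h0 | h0
  · rw [← h0]; exact mul_nonneg hΛ0 (Finset.sum_nonneg fun _ _ => by positivity)
  · refine le_of_mul_le_mul_right ?_ h0
    linarith

/-- Moments of twisted sums over a family of completely multiplicative real functions. -/
lemma sum_norm_pow_le {ι : Type*} (T : Finset ι) (χ : ι → ℕ → ℝ)
    (hχ1 : ∀ t, χ t 1 = 1) (hχm : ∀ t m n, χ t (m * n) = χ t m * χ t n) (Y ν : ℕ)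
    (a : ℕ → ℂ) (ha : ∀ n, ‖a n‖ ≤ 1) {Λ : ℝ} (hΛ0 : 0 ≤ Λ)
    (hΛ : ∀ t ∈ T, ∑ t' ∈ T, |∑ m ∈ Finset.Icc 1 (Y ^ ν), χ t m * χ t' m| ≤ Λ) :
    ∑ t ∈ T, ‖∑ n ∈ Finset.Icc 1 Y, a n * χ t n‖ ^ (2 * ν)
      ≤ Λ * ∑ m ∈ Finset.Icc 1 (Y ^ ν), (boxCount Y ν m : ℝ) ^ 2 := by
  set P := Fintype.piFinset fun _ : Fin ν => Finset.Icc 1 Y with hP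
  set b : ℕ → ℂ := fun m => ∑ f ∈ P with ∏ i, f i = m, ∏ i, a (f i) with hb
  have hprod : ∀ t, ∀ f : Fin ν → ℕ, χ t (∏ i, f i) = ∏ i, χ t (f i) := by
    intro t f
    exact map_prod (⟨⟨χ t, hχ1 t⟩, hχm t⟩ : ℕ →* ℝ) f Finset.univ
  -- Complete multiplicativity collects the `ν`-th power by the product `m` of the variables; since
  -- `‖a n‖ ≤ 1`, the coefficient of `m` is at most the number of its factorisations.
  have hpow : ∀ t, (∑ n ∈ Finset.Icc 1 Y, a n * χ t n) ^ ν
      = ∑ m ∈ Finset.Icc 1 (Y ^ ν), b m * χ t m := by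
    intro t
    have h1 : (∑ n ∈ Finset.Icc 1 Y, a n * χ t n) ^ ν = ∑ f ∈ P, ∏ i, (a (f i) * χ t (f i)) := by
      rw [hP, ← Finset.prod_univ_sum (fun _ => Finset.Icc 1 Y) (fun _ n => a n * (χ t n : ℂ))]
      simp
    rw [h1, ← Finset.sum_fiberwise_of_maps_to (fun f hf => prod_mem_Icc hf)]
    refine Finset.sum_congr rfl fun m _ => ?_
    rw [hb, Finset.sum_mul]
    refine Finset.sum_congr rfl fun f hf => ?_
    rw [← (Finset.mem_filter.1 hf).2, hprod, Finset.prod_mul_distrib]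
    push_cast; rfl
  have hbn : ∀ m, ‖b m‖ ≤ boxCount Y ν m := by
    intro m
    refine (norm_sum_le _ _).trans ?_
    rw [boxCount, Finset.card_eq_sum_ones, Nat.cast_sum]
    refine Finset.sum_le_sum fun f _ => ?_
    rw [norm_prod, Nat.cast_one]
    exact Finset.prod_le_one (fun _ _ => norm_nonneg _) fun _ _ => ha _
  have h := sum_norm_sq_le_of_kernel_le T (Finset.Icc 1 (Y ^ ν)) χ b hΛ0 hΛ
  calc _ = ∑ t ∈ T, ‖∑ m ∈ Finset.Icc 1 (Y ^ ν), b m * χ t m‖ ^ 2 := by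
        refine Finset.sum_congr rfl fun t _ => ?_
        rw [← hpow, norm_pow, ← pow_mul, mul_comm]
    _ ≤ _ := h
    _ ≤ _ := mul_le_mul_of_nonneg_left (Finset.sum_le_sum fun m _ =>
        pow_le_pow_left₀ (norm_nonneg _) (hbn m) 2) hΛ0

/-! ### Row sums of the kernel and the final estimate. -/

lemma maxCharSum_le {q : ℕ} {t : ℤ} {L : ℕ} (hL : 0 < L) {U : ℝ}
    (hU : ∀ N, N ≤ 2 * L → ‖∑ n ∈ Finset.Icc 1 N, (quadChar (Delta q t).toNat n : ℂ)‖ ≤ U) :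
    (maxCharSum q t L : ℝ) ≤ U := by
  obtain ⟨N, hN, h⟩ := Finset.exists_mem_eq_sup (Finset.Ioc L (2 * L))
    ⟨2 * L, Finset.mem_Ioc.2 ⟨by omega, le_rfl⟩⟩ fun N => (charSum q t N).natAbs
  rw [maxCharSum, h]
  refine le_trans (le_of_eq ?_) (hU N (Finset.mem_Ioc.1 hN).2)
  have : ∑ n ∈ Finset.Icc 1 N, (quadChar (Delta q t).toNat n : ℂ) = ((charSum q t N : ℤ) : ℂ) := by
    rw [charSum]; push_cast; rfl
  rw [this, Complex.norm_intCast, Nat.cast_natAbs, Int.cast_abs]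

lemma delta_bounds {q R : ℕ} (hR : R ^ 2 < q) {t : ℤ} (ht : t ∈ Finset.Ioc (R : ℤ) (2 * R)) :
    0 < t ∧ 0 < Delta q t ∧ Delta q t ≤ 4 * q := by
  rw [Finset.mem_Ioc] at ht
  have hR' : (R : ℤ) ^ 2 < q := by exact_mod_cast hR
  have hR0 : (0 : ℤ) ≤ R := by positivity
  unfold Delta
  exact ⟨by linarith, by nlinarith, by nlinarith [sq_nonneg t]⟩

/-- The `t'` with `Δ(t)Δ(t')` a square contribute at most `M` each and are few; the others, at most
`R` of them, are handled by Pólya–Vinogradov. -/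
lemma sum_kernel_le {p k q R : ℕ} (hp : p.Prime) (hq : p ^ k = q) (hR : R ^ 2 < q) (M : ℕ)
    {t : ℤ} (ht : t ∈ Finset.Ioc (R : ℤ) (2 * R)) :
    ∑ t' ∈ Finset.Ioc (R : ℤ) (2 * R), |∑ m ∈ Finset.Icc 1 M,
      (quadChar (Delta q t).toNat m : ℝ) * (quadChar (Delta q t').toNat m : ℝ)| ≤
      85 * (k + 1) * M + R * (24 * q * (6 + 2 * Real.log q)) := by
  set D := (Delta q t).toNat with hD
  set T := Finset.Ioc (R : ℤ) (2 * R) with hT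
  have hq0 : 0 < q := by omega
  have hqR : (0 : ℝ) < q := by exact_mod_cast hq0
  have hq1 : (1 : ℝ) ≤ q := by exact_mod_cast hq0
  have hlogq : 0 ≤ Real.log q := Real.log_nonneg hq1
  have hbd : ∀ s ∈ T, (Delta q s).toNat ≠ 0 ∧ (Delta q s).toNat ≤ 4 * q := by
    intro s hs
    have := delta_bounds hR hs
    omega
  have hmul : ∀ s ∈ T, ∀ m : ℕ, (quadChar D m : ℝ) * (quadChar (Delta q s).toNat m : ℝ)
      = (quadChar (D * (Delta q s).toNat) m : ℝ) := by
    intro s hs m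
    rw [quadChar_mul_right (hbd t ht).1 (hbd s hs).1]; push_cast; rfl
  rw [← Finset.sum_filter_add_sum_filter_not T fun s => IsSquare (D * (Delta q s).toNat)]
  refine add_le_add ?_ ?_
  · have hcard : (T.filter fun s => IsSquare (D * (Delta q s).toNat)).card ≤ 85 * (k + 1) := by
      refine card_isSquare_mul_le hp (hbd t ht).1 _ (fun s hs => ?_) fun s hs => ?_
      · rw [hq]
        have := delta_bounds hR (Finset.mem_filter.1 hs).1
        exact ⟨this.1, this.2.1⟩
      · rw [hq]; exact (Finset.mem_filter.1 hs).2
    calc _ ≤ ∑ s ∈ T.filter fun s => IsSquare (D * (Delta q s).toNat), (M : ℝ) := by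
          refine Finset.sum_le_sum fun s _ => (Finset.abs_sum_le_sum_abs _ _).trans ?_
          calc _ ≤ ∑ m ∈ Finset.Icc 1 M, (1 : ℝ) := by
                refine Finset.sum_le_sum fun m _ => ?_
                rw [abs_mul]
                have h1 : |(quadChar D m : ℝ)| ≤ 1 := by exact_mod_cast abs_quadChar_le_one D m
                have h2 : |(quadChar (Delta q s).toNat m : ℝ)| ≤ 1 := by
                  exact_mod_cast abs_quadChar_le_one (Delta q s).toNat m
                exact mul_le_one₀ h1 (abs_nonneg _) h2
            _ = M := by simp
      _ ≤ _ := by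
          rw [Finset.sum_const, nsmul_eq_mul]
          have : ((T.filter fun s => IsSquare (D * (Delta q s).toNat)).card : ℝ)
            ≤ 85 * (k + 1) := by exact_mod_cast hcard
          gcongr
  · have hbound : ∀ s ∈ T.filter (fun s => ¬ IsSquare (D * (Delta q s).toNat)),
        |∑ m ∈ Finset.Icc 1 M, (quadChar D m : ℝ) * (quadChar (Delta q s).toNat m : ℝ)|
          ≤ 24 * q * (6 + 2 * Real.log q) := by
      intro s hs
      rw [Finset.mem_filter] at hs
      have hDt := hbd t ht
      have hDs := hbd s hs.1
      set r := D * (Delta q s).toNat with hr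
      have hr0 : r ≠ 0 := mul_ne_zero hDt.1 hDs.1
      -- Both discriminants are at most `4q`, so `8r ≤ 128q²`. This gives `√(8r) ≤ 12q`, and `log
      -- 128 < 5`.
      have hrle : (8 * r : ℝ) ≤ 128 * (q : ℝ) ^ 2 := by
        have : r ≤ (4 * q) * (4 * q) := Nat.mul_le_mul hDt.2 hDs.2
        have : (r : ℝ) ≤ (4 * q) * (4 * q) := by exact_mod_cast this
        linarith
      have hrpos : (1 : ℝ) ≤ 8 * r := by
        have : (1 : ℝ) ≤ r := by exact_mod_cast Nat.one_le_iff_ne_zero.2 hr0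
        linarith
      rw [Finset.sum_congr rfl fun m _ => hmul s hs.1 m]
      refine (abs_sum_quadChar_le hr0 hs.2 M).trans ?_
      have h1 : Real.sqrt (8 * r) ≤ 12 * q := by
        rw [Real.sqrt_le_left (by positivity)]
        nlinarith
      have h2 : Real.log (8 * r) ≤ 5 + 2 * Real.log q := by
        refine (Real.log_le_log (by linarith) hrle).trans ?_
        rw [Real.log_mul (by norm_num) (by positivity), Real.log_pow,
          show (128 : ℝ) = 2 ^ 7 by norm_num, Real.log_pow]
        have := Real.log_two_lt_d9
        push_cast
        linarith
      have h3 : 0 ≤ Real.log (8 * r) := Real.log_nonneg hrpos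
      calc 2 * Real.sqrt (8 * r) * (1 + Real.log (8 * r))
          ≤ 2 * (12 * q) * (1 + (5 + 2 * Real.log q)) := by gcongr
        _ = _ := by ring
    refine (Finset.sum_le_sum hbound).trans ?_
    rw [Finset.sum_const, nsmul_eq_mul]
    refine mul_le_mul_of_nonneg_right ?_ (by positivity)
    have h1 : (T.filter fun s => ¬ IsSquare (D * (Delta q s).toNat)).card ≤ T.card :=
      Finset.card_filter_le _ _
    have h2 : T.card = R := by rw [hT, Int.card_Ioc]; omega
    rw [h2] at h1
    exact_mod_cast h1

/-- The bound for twisted sums over the family, before the factor coming from completion. -/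
lemma sum_norm_twisted_le {q R L ν : ℕ} (hq : IsPrimePow q) (hR0 : 0 < R) (hR : R ^ 2 < q)
    (hL : 0 < L) (hν : 0 < ν) (hX : (q : ℝ) * Real.sqrt R ≤ (L : ℝ) ^ ν)
    (a : ℕ → ℂ) (ha : ∀ n, ‖a n‖ ≤ 1) :
    ∑ t ∈ Finset.Ioc (R : ℤ) (2 * R),
      ‖∑ n ∈ Finset.Icc 1 (2 * L), a n * (quadChar (Delta q t).toNat n : ℝ)‖ ≤
      (R : ℝ) ^ (1 - 1 / (4 * (ν : ℝ))) * (2 * L) *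
        (Real.exp 1 * Real.log (2 * L) / ν + Real.exp 1) ^ ((ν : ℝ) / 2) *
        (32 * (1 + Real.log L)) := by
  obtain ⟨p, k, hp, hk, hpk⟩ := (isPrimePow_nat_iff q).1 hq
  have hRr : (1 : ℝ) ≤ R := by exact_mod_cast hR0
  have hLr : (1 : ℝ) ≤ L := by exact_mod_cast hL
  have hνr : (1 : ℝ) ≤ ν := by exact_mod_cast hν
  have hq1 : (1 : ℝ) ≤ q := by exact_mod_cast (by omega : 1 ≤ q)
  have hlogL : 0 ≤ Real.log L := Real.log_nonneg hLr
  have hlogq : 0 ≤ Real.log q := Real.log_nonneg hq1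
  have hlog2L : 0 ≤ Real.log (2 * L) := Real.log_nonneg (by linarith)
  have hsqrtR : 1 ≤ Real.sqrt R := Real.one_le_sqrt.2 hRr
  set F := Real.exp 1 * Real.log (2 * L) / ν + Real.exp 1 with hF
  have hF0 : 0 < F := by positivity
  set T := Finset.Ioc (R : ℤ) (2 * R) with hT
  have hTcard : T.card = R := by rw [hT, Int.card_Ioc]; omega
  set χ : ℤ → ℕ → ℝ := fun t n => (quadChar (Delta q t).toNat n : ℝ) with hχ
  set Λ : ℝ := Real.sqrt R * (2 * L) ^ ν * (229 * (ν * (1 + Real.log L))) with hΛ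
  have hqL : Real.log q ≤ ν * Real.log L := by
    rw [← Real.log_pow]
    exact Real.log_le_log (by linarith) (le_trans (by nlinarith) hX)
  have hkq : (k : ℝ) ≤ 2 * Real.log q := by
    have h1 : (2 : ℝ) ^ k ≤ q := by
      rw [← hpk]; exact_mod_cast Nat.pow_le_pow_left hp.two_le k
    have h2 := Real.log_le_log (by positivity) h1
    rw [Real.log_pow] at h2
    have := Real.log_two_gt_d9
    have hk0 : (0 : ℝ) ≤ k := by positivity
    nlinarith
  have hkernel : ∀ t ∈ T, ∑ t' ∈ T, |∑ m ∈ Finset.Icc 1 ((2 * L) ^ ν), χ t m * χ t' m| ≤ Λ := by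
    intro t ht
    refine (sum_kernel_le hp hpk hR _ ht).trans ?_
    push_cast
    have hpow : (L : ℝ) ^ ν ≤ (2 * L : ℝ) ^ ν := pow_le_pow_left₀ (by linarith) (by linarith) _
    set P := (2 * L : ℝ) ^ ν with hP
    have hP0 : 0 < P := by positivity
    have e1 : 85 * ((k : ℝ) + 1) * P ≤ Real.sqrt R * P * (85 * (1 + 2 * Real.log q)) := by
      calc 85 * ((k : ℝ) + 1) * P ≤ 85 * (2 * Real.log q + 1) * P := by gcongr
        _ = 1 * P * (85 * (1 + 2 * Real.log q)) := by ring
        _ ≤ _ := by gcongr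
    -- The size condition on `L^ν` enters here: `Rq = √R · q√R ≤ √R · L^ν`. Keeping only `√R` in
    -- place of `R` is the source of the saving `R^(-1/(4ν))`.
    have e2 : (R : ℝ) * (24 * q * (6 + 2 * Real.log q))
        ≤ Real.sqrt R * P * (24 * (6 + 2 * Real.log q)) := by
      have : (R : ℝ) * q ≤ Real.sqrt R * P := by
        calc (R : ℝ) * q = Real.sqrt R * (q * Real.sqrt R) := by
              nth_rewrite 1 [← Real.mul_self_sqrt (by linarith : (0 : ℝ) ≤ R)]; ring
          _ ≤ Real.sqrt R * P := by gcongr; exact hX.trans hpow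
      calc (R : ℝ) * (24 * q * (6 + 2 * Real.log q))
          = (R * q) * (24 * (6 + 2 * Real.log q)) := by ring
        _ ≤ _ := by gcongr
    -- The constant is `229 = 85 + 24 · 6`; `log q ≤ ν log L` replaces `log q`.
    have e3 : 85 * (1 + 2 * Real.log q) + 24 * (6 + 2 * Real.log q)
        ≤ 229 * (ν * (1 + Real.log L)) := by nlinarith
    calc _ ≤ Real.sqrt R * P * (85 * (1 + 2 * Real.log q) + 24 * (6 + 2 * Real.log q)) := by
          linarith [mul_add (Real.sqrt R * P) (85 * (1 + 2 * Real.log q)) (24 * (6 + 2 * Real.log q))]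
      _ ≤ _ := by rw [hΛ]; gcongr
  have hΛ0 : 0 ≤ Λ := by positivity
  have hmom := sum_norm_pow_le T χ (fun t => by simp [hχ, quadChar_one_right])
    (fun t m n => by simp [hχ, quadChar_mul_left]) (2 * L) ν a ha hΛ0 hkernel
  have hE := sum_boxCount_sq_le_rankin (Y := 2 * L) (by omega) hν
  push_cast at hE
  set S := ∑ t ∈ T, ‖∑ n ∈ Finset.Icc 1 (2 * L), a n * (χ t n : ℂ)‖ with hS
  have hS0 : 0 ≤ S := Finset.sum_nonneg fun _ _ => norm_nonneg _
  -- Hölder's inequality over the `R` values of `t`.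
  have hmean : S ^ (2 * ν) ≤ (R : ℝ) ^ (2 * ν - 1) *
      ∑ t ∈ T, ‖∑ n ∈ Finset.Icc 1 (2 * L), a n * (χ t n : ℂ)‖ ^ (2 * ν) := by
    obtain ⟨n, hn⟩ : ∃ n, 2 * ν = n + 1 := ⟨2 * ν - 1, by omega⟩
    have h := pow_sum_le_card_mul_sum_pow (s := T) (f := fun t =>
      ‖∑ n ∈ Finset.Icc 1 (2 * L), a n * (χ t n : ℂ)‖) (fun _ _ => norm_nonneg _) n
    rw [hTcard] at h
    rw [hn]
    exact h
  set W := (R : ℝ) ^ (1 - 1 / (4 * (ν : ℝ))) * (2 * L) * F ^ ((ν : ℝ) / 2) *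
    (32 * (1 + Real.log L)) with hW
  have hW0 : 0 ≤ W := by positivity
  suffices S ^ (2 * ν) ≤ W ^ (2 * ν) from
    le_of_pow_le_pow_left₀ (by omega) hW0 this
  have hWpow : W ^ (2 * ν) = (R : ℝ) ^ (2 * ν - 1) * Real.sqrt R * ((2 * L) ^ ν * (2 * L) ^ ν) *
      (F ^ ν) ^ ν * (32 * (1 + Real.log L)) ^ (2 * ν) := by
    have h1 : ((R : ℝ) ^ (1 - 1 / (4 * (ν : ℝ)))) ^ (2 * ν)
        = (R : ℝ) ^ (2 * ν - 1) * Real.sqrt R := by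
      rw [← Real.rpow_mul_natCast (by linarith), Real.sqrt_eq_rpow, ← Real.rpow_natCast (R : ℝ),
        ← Real.rpow_add (by linarith), Nat.cast_sub (by omega)]
      congr 1
      push_cast
      field_simp
      ring
    have h2 : (F ^ ((ν : ℝ) / 2)) ^ (2 * ν) = (F ^ ν) ^ ν := by
      rw [← Real.rpow_mul_natCast hF0.le, ← pow_mul, ← Real.rpow_natCast]
      congr 1
      push_cast
      ring
    rw [hW, mul_pow, mul_pow, mul_pow, h1, h2, two_mul ν, pow_add (2 * (L : ℝ))]
  -- The factor `ν` is absorbed by `229ν ≤ 512^ν · 2^ν = 32^(2ν)`, so after the `2ν`-th root the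
  -- loss is `32(1 + log L)`, uniformly in `ν`; this is why `η` can depend on `L` only.
  have hconst : 229 * (ν * (1 + Real.log L)) ≤ (32 * (1 + Real.log L)) ^ (2 * ν) := by
    rw [mul_pow]
    have h1 : (229 * ν : ℝ) ≤ 32 ^ (2 * ν) := by
      rw [pow_mul]
      have h3 : (ν : ℝ) ≤ 2 ^ ν := by exact_mod_cast Nat.lt_two_pow_self.le
      have h4 : (512 : ℝ) ≤ 512 ^ ν := le_self_pow₀ (by norm_num) (by omega)
      calc (229 * ν : ℝ) ≤ 512 ^ ν * 2 ^ ν := by gcongr; linarith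
        _ = (32 ^ 2) ^ ν := by rw [← mul_pow]; norm_num
    have h2 : 1 + Real.log L ≤ (1 + Real.log L) ^ (2 * ν) := le_self_pow₀ (by linarith) (by omega)
    calc 229 * (ν * (1 + Real.log L)) = (229 * ν) * (1 + Real.log L) := by ring
      _ ≤ _ := by gcongr
  calc S ^ (2 * ν) ≤ (R : ℝ) ^ (2 * ν - 1) * (Λ * (2 * L * F ^ ν) ^ ν) := by
        refine hmean.trans (mul_le_mul_of_nonneg_left (hmom.trans ?_) (by positivity))
        exact mul_le_mul_of_nonneg_left hE hΛ0
    _ = (R : ℝ) ^ (2 * ν - 1) * Real.sqrt R * ((2 * L) ^ ν * (2 * L) ^ ν) *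
      (F ^ ν) ^ ν * (229 * (ν * (1 + Real.log L))) := by rw [hΛ, mul_pow]; ring
    _ ≤ W ^ (2 * ν) := by rw [hWpow]; gcongr

/-- The exponent `η(L)` for which `L ^ η(L) = 64 (3 + log L)²`. -/
noncomputable def lossExponent (L : ℕ) : ℝ :=
  Real.log (64 * (3 + Real.log L) ^ 2) / Real.log L

lemma tendsto_lossExponent : Filter.Tendsto lossExponent Filter.atTop (nhds 0) := by
  have hreal : Filter.Tendsto (fun x : ℝ => Real.log (64 * (3 + x) ^ 2) / x) Filter.atTop
      (nhds 0) := by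
    have h3 : Filter.Tendsto (fun x : ℝ => 3 + x) Filter.atTop Filter.atTop :=
      Filter.tendsto_atTop_add_const_left _ _ Filter.tendsto_id
    have hl : (fun x : ℝ => Real.log (3 + x)) =o[Filter.atTop] fun x : ℝ => x := by
      refine (Real.isLittleO_log_id_atTop.comp_tendsto h3).trans_isBigO ?_
      refine Asymptotics.IsBigO.of_bound 2 ?_
      filter_upwards [Filter.eventually_ge_atTop 3] with x hx
      simp only [Function.comp, id, Real.norm_eq_abs]
      rw [abs_of_nonneg (by linarith), abs_of_nonneg (by linarith)]
      linarith
    have hc : (fun _ : ℝ => Real.log 64) =o[Filter.atTop] fun x : ℝ => x :=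
      Asymptotics.isLittleO_const_id_atTop _
    refine ((hc.add (hl.const_mul_left 2)).tendsto_div_nhds_zero).congr' ?_
    filter_upwards [Filter.eventually_ge_atTop 0] with x hx
    rw [Real.log_mul (by norm_num) (by positivity), Real.log_pow]
    norm_num
  exact hreal.comp (Real.tendsto_log_atTop.comp tendsto_natCast_atTop_atTop)

theorem lemma2p4 :
    ∃ η : ℕ → ℝ, Filter.Tendsto η Filter.atTop (nhds 0) ∧
      ∀ q R L ν : ℕ, IsPrimePow q → 0 < R → 2 * (R : ℝ) < 2 * Real.sqrt (q : ℝ) →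
        0 < L → 0 < ν → boundX q R ≤ (L : ℝ) ^ ν →
        ∑ t ∈ Finset.Ioc (R : ℤ) (2 * (R : ℤ)), (maxCharSum q t L : ℝ) ≤
          (R : ℝ) ^ (1 - 1 / (4 * (ν : ℝ))) * (L : ℝ) ^ (1 + η L) *
            (Real.exp 1 * Real.log (2 * (L : ℝ)) / (ν : ℝ) + Real.exp 1) ^ ((ν : ℝ) / 2) := by
  refine ⟨lossExponent, tendsto_lossExponent, ?_⟩
  intro q R L ν hq hR0 hRq hL hν hX
  have hX' : (q : ℝ) * Real.sqrt R ≤ (L : ℝ) ^ ν := (le_max_left _ _).trans hX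
  have hR : R ^ 2 < q := by
    have h : (R : ℝ) < Real.sqrt q := by linarith
    have := (Real.lt_sqrt (by positivity)).1 h
    exact_mod_cast this
  have hRr : (1 : ℝ) ≤ R := by exact_mod_cast hR0
  -- For `L = 1` the size condition would say `q√R ≤ 1`. Excluding it makes `log L` positive, as the
  -- identity for `L ^ lossExponent L` requires.
  have hL2 : 2 ≤ L := by
    by_contra h
    have h1 : L = 1 := by omega
    rw [h1, Nat.cast_one, one_pow] at hX'
    have h2 : (2 : ℝ) ≤ q := by exact_mod_cast hq.two_le
    nlinarith [Real.one_le_sqrt.2 hRr]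
  have hLr : (2 : ℝ) ≤ L := by exact_mod_cast hL2
  have hlogL : 0 < Real.log L := Real.log_pos (by linarith)
  have hlog2L : Real.log (2 * L) ≤ 1 + Real.log L := by
    rw [Real.log_mul (by norm_num) (by linarith)]
    have := Real.log_two_lt_d9
    linarith
  have hlog2L0 : 0 ≤ Real.log (2 * L) := Real.log_nonneg (by linarith)
  have hK : NeZero (2 * L) := ⟨by omega⟩
  set T := Finset.Ioc (R : ℤ) (2 * R) with hT
  set Z : ZMod (2 * L) → ℤ → ℝ := fun h t => ‖∑ n ∈ Finset.Icc 1 (2 * L),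
    ZMod.stdAddChar (-(h * (n : ZMod (2 * L)))) * ((quadChar (Delta q t).toNat n : ℝ) : ℂ)‖ with hZ
  -- The right side is independent of `N`, so the maximum disappears; the modulus `2L` covers every
  -- `N ≤ 2L`.
  have hmax : ∀ t, (maxCharSum q t L : ℝ) ≤
      ∑ h : ZMod (2 * L), kernelWeight (2 * L) h.val * Z h t := by
    intro t
    refine maxCharSum_le hL fun N hN => (norm_partial_sum_le hN _).trans (le_of_eq ?_)
    refine Finset.sum_congr rfl fun h _ => ?_
    rw [hZ]
    congr 2
    refine Finset.sum_congr rfl fun n _ => ?_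
    rw [mul_comm]; push_cast; rfl
  set F := Real.exp 1 * Real.log (2 * L) / ν + Real.exp 1 with hF
  have hF0 : 0 < F := by positivity
  set W := (R : ℝ) ^ (1 - 1 / (4 * (ν : ℝ))) * (2 * L) * F ^ ((ν : ℝ) / 2) *
    (32 * (1 + Real.log L)) with hW
  have hW0 : 0 ≤ W := by positivity
  have hZW : ∀ h, ∑ t ∈ T, Z h t ≤ W := fun h =>
    sum_norm_twisted_le hq hR0 hR hL hν hX' _ fun n => (norm_stdAddChar _).le
  have hpow : (L : ℝ) ^ (1 + lossExponent L) = L * (64 * (3 + Real.log L) ^ 2) := by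
    rw [Real.rpow_add (by linarith), Real.rpow_one, Real.rpow_def_of_pos (by linarith),
      lossExponent, mul_div_cancel₀ _ hlogL.ne', Real.exp_log (by positivity)]
  calc ∑ t ∈ T, (maxCharSum q t L : ℝ)
      ≤ ∑ t ∈ T, ∑ h : ZMod (2 * L), kernelWeight (2 * L) h.val * Z h t :=
        Finset.sum_le_sum fun t _ => hmax t
    _ = ∑ h : ZMod (2 * L), kernelWeight (2 * L) h.val * ∑ t ∈ T, Z h t := by
        rw [Finset.sum_comm]
        exact Finset.sum_congr rfl fun h _ => (Finset.mul_sum _ _ _).symm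
    _ ≤ ∑ h : ZMod (2 * L), kernelWeight (2 * L) h.val * W :=
        Finset.sum_le_sum fun h _ =>
          mul_le_mul_of_nonneg_left (hZW h) (kernelWeight_nonneg (ZMod.val_lt h))
    -- The weights sum to at most `2 + log(2L) ≤ 3 + log L`. The constant `64` in `lossExponent` is
    -- `2 · 32`, from the length `2L` and from `W`.
    _ ≤ (3 + Real.log L) * W := by
        rw [← Finset.sum_mul]
        refine mul_le_mul_of_nonneg_right ((sum_kernelWeight_le _).trans ?_) hW0
        push_cast
        linarith
    _ = (R : ℝ) ^ (1 - 1 / (4 * (ν : ℝ))) * (L * (64 * ((3 + Real.log L) * (1 + Real.log L)))) *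
        F ^ ((ν : ℝ) / 2) := by rw [hW]; ring
    _ ≤ (R : ℝ) ^ (1 - 1 / (4 * (ν : ℝ))) * (L : ℝ) ^ (1 + lossExponent L) *
        F ^ ((ν : ℝ) / 2) := by
        rw [hpow]
        gcongr
        nlinarith
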